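/- Let $G$ be a simple undirected graph of arbitrary (finite or infinite) cardinality, and let $k\in\mathbb N$. Then $G$ has a $k$-lean tree-decomposition. Here a tree-decomposition of $G$ is a pair $(T,(V_t)_{t\in V(T)})$ consisting of a (possibly infinite) tree $T$ and sets $V_t\subseteq V(G)$, called parts, such that $\bigcup_t V_t=V(G)$, every edge of $G$ has both its ends in some $V_t$, and $V_{t_1}\cap V_{t_3}\subseteq V_{t_2}$ whenever $t_2$ lies on the path in $T$ between $t_1$ and $t_3$. An edge $tt'$ of $T$ induces the separation $(A,B)$ of $G$, where $A$ and $B$ are the unions of the parts at the nodes of the component of $T-tt'$ containing $t$ and of the one containing $t'$, respectively; its order is $|A\cap B|$. For sets $Z_1,Z_2\subseteq V(G)$, a $Z_1$–$Z_2$ path is a finite (possibly trivial) path with one endvertex in $Z_1$, the other in $Z_2$, and no inner vertex in $Z_1\cup Z_2$. The tree-decomposition is $k$-lean if $|V_t\cap V_{t'}|<k$ for every edge $tt'$ of $T$ and, for all (not necessarily distinct) nodes $t_1,t_2$ of $T$ and all sets $Z_1\subseteq V_{t_1}$, $Z_2\subseteq V_{t_2}$ with $|Z_1|=|Z_2|=\ell\le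 k$, either $G$ contains $\ell$ pairwise vertex-disjoint $Z_1$–$Z_2$ paths, or some edge of the path in $T$ between $t_1$ and $t_2$ induces a separation of $G$ of order less than $\ell$. -/

import Mathlib

universe u

namespace SimpleGraph

variable {V : Type u} (G : SimpleGraph V)

/-- A walk from `u` to `v` is an `A`-`B` path if it is a path that starts in `A`, ends in `B`,
and whose inner vertices (those other than `u` and `v`) lie outside `A ∪ B`.
The trivial path at a vertex of `A ∩ B` is allowed. -/
def IsSetPath {G : SimpleGraph V} (A B : Set V) {u v : V} (p : G.Walk u v) : Prop :=
  p.IsPath ∧ u ∈ A ∧ v ∈ B ∧ ∀ w ∈ p.support, w ≠ u → w ≠ v → w ∉ A ∪ B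

/-- `G` contains `l` pairwise vertex-disjoint `A`-`B` paths. -/
def HasDisjointSetPaths (A B : Set V) (l : ℕ) : Prop :=
  ∃ (a b : Fin l → V) (p : ∀ i, G.Walk (a i) (b i)),
    (∀ i, IsSetPath A B (p i)) ∧
    ∀ i j, i ≠ j → List.Disjoint (p i).support (p j).support

/-- A tree-decomposition of `G`: a (possibly infinite) tree together with a family of vertex sets
of `G` (the parts), indexed by the nodes of the tree. -/
structure TreeDecomposition where
  /-- the nodes of the decomposition tree -/
  Node : Type u
  /-- the decomposition tree -/
  tree : SimpleGraph Node
  isTree : tree.IsTree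
  /-- the parts -/
  part : Node → Set V
  /-- the parts cover the vertex set -/
  iUnion_part : ⋃ t, part t = Set.univ
  /-- every edge has both ends in a common part -/
  exists_part_of_adj : ∀ v w, G.Adj v w → ∃ t, v ∈ part t ∧ w ∈ part t
  /-- if `t₂` lies on the path of the tree between `t₁` and `t₃`,
  then `part t₁ ∩ part t₃ ⊆ part t₂` -/
  inter_subset : ∀ (t₁ t₂ t₃ : Node) (p : tree.Walk t₁ t₃), p.IsPath → t₂ ∈ p.support →
    part t₁ ∩ part t₃ ⊆ part t₂

namespace TreeDecomposition

variable {G} (D : TreeDecomposition G)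

/-- All adhesion sets `part t ∩ part t'`, for edges `tt'` of the tree, have fewer than `k`
elements. -/
def AdhesionLT (k : ℕ) : Prop :=
  ∀ t t', D.tree.Adj t t' → (D.part t ∩ D.part t').encard < k

/-- For an edge `tt'` of the tree, the union of the parts at the nodes in the component of
`tree - tt'` that contains `t`. The edge `tt'` induces the separation
`(D.side t t', D.side t' t)` of `G`. -/
def side (t t' : D.Node) : Set V :=
  ⋃ s ∈ {s : D.Node | (D.tree.deleteEdges {s(t, t')}).Reachable t s}, D.part s

/-- The order of the separation of `G` that is induced by the edge `tt'` of the tree. -/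
noncomputable def sepOrder (t t' : D.Node) : ℕ∞ :=
  (D.side t t' ∩ D.side t' t).encard

/-- A tree-decomposition is `k`-lean if it has adhesion less than `k` and, for any two (not
necessarily distinct) nodes `t₁`, `t₂` and sets `Z₁ ⊆ part t₁`, `Z₂ ⊆ part t₂` of the same size
`l ≤ k`, either `G` contains `l` disjoint `Z₁`-`Z₂` paths, or some edge on the path between `t₁`
and `t₂` in the tree induces a separation of order less than `l`. -/
def IsLeanUpTo (k : ℕ) : Prop :=
  D.AdhesionLT k ∧
  ∀ (t₁ t₂ : D.Node) (Z₁ Z₂ : Set V) (l : ℕ),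
    Z₁ ⊆ D.part t₁ → Z₂ ⊆ D.part t₂ → Z₁.encard = l → Z₂.encard = l → l ≤ k →
      G.HasDisjointSetPaths Z₁ Z₂ l ∨
      ∃ p : D.tree.Walk t₁ t₂, p.IsPath ∧ ∃ t t', s(t, t') ∈ p.edges ∧ D.sepOrder t t' < l

end TreeDecomposition

end SimpleGraph

/-!
The decomposition is obtained from finite subgraphs by compactness.

For a finite graph, take among all tree-decompositions of adhesion less than `k` one whose family of
large subsets of parts is minimal (`FacesLT`). If it is not `k`-lean, Menger's theorem
(`linked_of_forall_separates`) yields a separation `(A, B)` of order `m < k` and two nodes `t₁`,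
`t₂`, not separated by an adhesion set of size at most `m`, such that the part at `t₁` has more
than `m` vertices in `A` and the part at `t₂` has more than `m` vertices in `B` (`Bad`). For a
suitably minimal choice (`MinBad`), splitting the tree-decomposition along `(A, B)` into two copies,
with the vertices of `A ∩ B` added to the parts on the way to `t₂` in the copy for `A` and to `t₁`
in the copy for `B`, does not increase the adhesion, leaves the parts inside `A` or inside `B` as
they are, up to additional parts of at most `m` vertices, and replaces every part that meets both
`A \ B` and `B \ A` by two smaller ones (`MinBad.uncross_node`). This contradicts minimality, since
such a part of size more than `m` exists.

For a tree-decomposition of `G`, let `H` be the graph in which two vertices are adjacent if they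
share a part. Those properties of `H` that matter (`LeanCompletion`) speak about finitely many
vertices at a time, so the graphs `H` for the finite induced subgraphs of an arbitrary graph have a
limit along an ultrafilter that again has these properties (`exists_leanCompletion`). Leanness takes
the following form: if `Z₁` and `Z₂` are sets of `l ≤ k` vertices that are joined by a sequence of
`l`-sets in which the union of any two consecutive sets is a clique of `H`, then `G` contains `l`
disjoint `Z₁`-`Z₂` paths.

Finally, the limit `H` is decomposed into cliques: delete a maximal clique, and repeat this in every
component of the rest, each time with a maximal clique that contains the neighbourhood of the
component. As `H` is a limit of chordal graphs in which no two non-adjacent vertices have a clique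
of `k` common neighbours, this neighbourhood has fewer than `k` vertices
(`encard_boundary_cell_lt`). It is this bound that makes the procedure exhaust `H` after `ω` steps
(`exists_mem_bag_cell`): the neighbourhood of a limit of components is finite, hence contained in
the neighbourhood of one of the components, which forces the components to become stationary. The
resulting tree-decomposition of `H` is a `k`-lean tree-decomposition of `G`: if all adhesion sets
between two nodes have at least `l` elements, then `l`-subsets of them form a sequence of `l`-sets
as above.
-/

namespace SimpleGraph

/-! ### Reachability inside a vertex set -/

/-- `b` can be reached from `a` by a walk of `G` all of whose vertices lie in `S`. In particular
`a` and `b` lie in `S`. -/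
def ReachableIn {V : Type*} (G : SimpleGraph V) (S : Set V) (a b : V) : Prop :=
  ∃ w : G.Walk a b, ∀ c ∈ w.support, c ∈ S

namespace ReachableIn

variable {V : Type*} {G G' : SimpleGraph V} {S S' : Set V} {a b c : V}

theorem refl (h : a ∈ S) : G.ReachableIn S a a := ⟨.nil, by simpa using h⟩

theorem symm (h : G.ReachableIn S a b) : G.ReachableIn S b a := by
  obtain ⟨w, hw⟩ := h
  exact ⟨w.reverse, by simpa using hw⟩

theorem trans (h : G.ReachableIn S a b) (h' : G.ReachableIn S b c) : G.ReachableIn S a c := by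
  obtain ⟨w, hw⟩ := h
  obtain ⟨w', hw'⟩ := h'
  refine ⟨w.append w', fun x hx => ?_⟩
  rcases Walk.mem_support_append_iff _ _ |>.1 hx with h | h
  exacts [hw x h, hw' x h]

theorem mono (hG : G ≤ G') (hS : S ⊆ S') (h : G.ReachableIn S a b) : G'.ReachableIn S' a b := by
  obtain ⟨w, hw⟩ := h
  exact ⟨w.mapLe hG, by simpa using fun c hc => hS (hw c hc)⟩

theorem left_mem (h : G.ReachableIn S a b) : a ∈ S := by
  obtain ⟨w, hw⟩ := h
  exact hw _ w.start_mem_support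

theorem right_mem (h : G.ReachableIn S a b) : b ∈ S := h.symm.left_mem

theorem of_adj (h : G.Adj a b) (ha : a ∈ S) (hb : b ∈ S) : G.ReachableIn S a b :=
  ⟨h.toWalk, by simp [ha, hb]⟩

/-- A property that is inherited along the edges inside `S` is inherited along walks
inside `S`. -/
theorem induct {P : V → Prop} (h : G.ReachableIn S a b) (ha : P a)
    (step : ∀ x y, G.ReachableIn S a x → y ∈ S → G.Adj x y → P x → P y) : P b := by
  have key : ∀ x y (w : G.Walk x y), (∀ c ∈ w.support, c ∈ S) → G.ReachableIn S a x → P x →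
      P y := by
    intro x y w
    induction w with
    | nil => exact fun _ _ h => h
    | cons hadj w ih =>
      intro hc hx hP
      have hy : _ ∈ S := hc _ (List.mem_cons_of_mem _ w.start_mem_support)
      exact ih (fun c h => hc c (List.mem_cons_of_mem _ h))
        (hx.trans (of_adj hadj hx.right_mem hy)) (step _ _ hx hy hadj hP)
  obtain ⟨w, hw⟩ := h
  exact key a b w hw (refl (hw _ w.start_mem_support)) ha

/-- A walk that leaves the set `T` does so along some edge. -/
theorem exists_exit {T : Set V} (h : G.ReachableIn S a b) (ha : a ∈ T) (hb : b ∉ T) :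
    ∃ x y, G.ReachableIn (S ∩ T) a x ∧ y ∈ S ∧ y ∉ T ∧ G.Adj x y := by
  by_contra! hcon
  have : G.ReachableIn (S ∩ T) a b := by
    refine h.induct (refl ⟨h.left_mem, ha⟩) fun x y _ hy hxy hx => ?_
    have hyT : y ∈ T := by
      by_contra hyT
      exact hcon x y hx hy hyT hxy
    exact hx.trans (of_adj hxy hx.right_mem ⟨hy, hyT⟩)
  exact hb this.right_mem.2

theorem of_reachable (h : G.Reachable a b) : G.ReachableIn Set.univ a b := by
  obtain ⟨w⟩ := h
  exact ⟨w, fun _ _ => trivial⟩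

theorem reachable (h : G.ReachableIn S a b) : G.Reachable a b := ⟨h.choose⟩

/-- Every vertex on a walk inside `S` is reachable inside `S`. -/
theorem of_mem_support {w : G.Walk a b} (hw : ∀ c ∈ w.support, c ∈ S) (hc : c ∈ w.support) :
    G.ReachableIn S a c := by
  classical
  exact ⟨w.takeUntil c hc, fun d hd => hw d (w.support_takeUntil_subset_support hc hd)⟩

theorem inter_reachable (h : G.ReachableIn S a b) :
    G.ReachableIn {c | G.ReachableIn S a c} a b := by
  obtain ⟨w, hw⟩ := h
  exact ⟨w, fun c hc => of_mem_support hw hc⟩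

end ReachableIn

/-! ### Menger's theorem for finite graphs -/

/-- `G` contains `n` disjoint connections from `A` to `B`, each given as a vertex set containing
the vertices of a walk from `A` to `B`. -/
def Linked {V : Type*} (G : SimpleGraph V) (A B : Set V) (n : ℕ) : Prop :=
  ∃ c : Fin n → Set V, Pairwise (fun i j => Disjoint (c i) (c j)) ∧
    ∀ i, ∃ a ∈ A, ∃ b ∈ B, G.ReachableIn (c i) a b

/-- Every walk of `G` from `A` to `B` meets `X`. -/
def Separates {V : Type*} (G : SimpleGraph V) (X A B : Set V) : Prop :=
  ∀ a ∈ A, ∀ b ∈ B, ¬ G.ReachableIn Xᶜ a b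

variable {V : Type*}

theorem Separates.symm {G : SimpleGraph V} {X A B : Set V} (h : G.Separates X A B) :
    G.Separates X B A := fun a ha b hb hab => h b hb a ha hab.symm

/-- If `n` disjoint connections end in a set of `n` vertices, they can be indexed by their ends. -/
theorem Linked.exists_index [Finite V] {G : SimpleGraph V} {A X : Set V} {n : ℕ}
    (h : G.Linked A X n) (hX : X.ncard = n) :
    ∃ c : V → Set V, (∀ u ∈ X, ∀ v ∈ X, u ≠ v → Disjoint (c u) (c v)) ∧
      ∀ v ∈ X, ∃ a ∈ A, G.ReachableIn (c v) a v := by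
  obtain ⟨c, hc, h⟩ := h
  choose a ha b hb hab using h
  have hinj : Function.Injective b := by
    intro i j hij
    by_contra hne
    exact (hc hne).ne_of_mem (hab i).right_mem (hab j).right_mem hij
  have hrange : Set.range b = X := by
    refine Set.eq_of_subset_of_ncard_le (Set.range_subset_iff.2 hb) ?_ (Set.toFinite _)
    rw [hX, ← Set.image_univ, Set.ncard_image_of_injective _ hinj, Set.ncard_univ]
    simp
  have hsur : ∀ v ∈ X, ∃ i, b i = v := fun v hv => by rwa [← hrange] at hv
  refine ⟨fun v => {w | ∃ i, b i = v ∧ w ∈ c i}, fun u hu v hv huv => ?_, fun v hv => ?_⟩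
  · refine Set.disjoint_left.2 ?_
    rintro w ⟨i, hi, hwi⟩ ⟨j, hj, hwj⟩
    exact (hc fun h : i = j => huv (by rw [← hi, ← hj, h])).ne_of_mem hwi hwj rfl
  · obtain ⟨i, rfl⟩ := hsur v hv
    exact ⟨a i, ha i, (hab i).mono le_rfl fun w hw => ⟨i, rfl, hw⟩⟩

theorem Linked.of_index [Finite V] {G : SimpleGraph V} {A B X : Set V} {n : ℕ} (hX : X.ncard = n)
    (c : V → Set V) (hc : ∀ u ∈ X, ∀ v ∈ X, u ≠ v → Disjoint (c u) (c v))
    (h : ∀ v ∈ X, ∃ a ∈ A, ∃ b ∈ B, G.ReachableIn (c v) a b) : G.Linked A B n := by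
  have : Nat.card X = n := hX
  let e : Fin n ≃ X := (Finite.equivFinOfCardEq this).symm
  refine ⟨fun i => c (e i), fun i j hij => hc _ (e i).2 _ (e j).2 fun h => hij ?_,
    fun i => h _ (e i).2⟩
  exact e.injective (Subtype.ext h)

/-- One half of the induction step in Menger's theorem. Here `S` separates `A` from `B` in
`G - xy` but not in `G`, and `x` is on the side of `A`. Then `G - xy` has as many disjoint
connections from `A` to `S ∪ {x}` as `G` is supposed to have from `A` to `B`; they can be chosen
to meet `S ∪ {x}` only in their ends and to stay on the side of `A`. -/
theorem exists_half_linkage [Finite V] {G G' : SimpleGraph V} {A B S : Set V} {n : ℕ} {x y : V}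
    (hG : ∀ u v, G.Adj u v → G'.Adj u v ∨ s(u, v) = s(x, y))
    (ih : ∀ A B : Set V, (∀ X, G'.Separates X A B → n ≤ X.ncard) → G'.Linked A B n)
    (h : ∀ X, G.Separates X A B → n ≤ X.ncard) (hS : G'.Separates S A B)
    (hX : (insert x S).ncard = n) (hx : ∃ a ∈ A, G'.ReachableIn Sᶜ a x)
    (hy : ∀ a ∈ A, ¬ G'.ReachableIn Sᶜ a y) :
    ∃ c : V → Set V, (∀ u ∈ insert x S, ∀ v ∈ insert x S, u ≠ v → Disjoint (c u) (c v)) ∧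
      ∀ v ∈ insert x S, c v ⊆ insert v {w | ∃ a ∈ A, G'.ReachableIn Sᶜ a w} ∧
        ∃ a ∈ A, G'.ReachableIn (c v) a v := by
  set RA : Set V := {w | ∃ a ∈ A, G'.ReachableIn Sᶜ a w} with hRA
  have hxRA : x ∈ RA := hx
  have hyRA : y ∉ RA := fun ⟨a, ha, h⟩ => hy a ha h
  have hadjRA : ∀ u w, u ∈ RA → w ∉ S → G'.Adj u w → w ∈ RA := by
    rintro u w ⟨a, ha, hau⟩ hw huw
    exact ⟨a, ha, hau.trans (.of_adj huw hau.right_mem hw)⟩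
  have hlink : G'.Linked A (insert x S) n := by
    refine ih _ _ fun R hR => h R fun a ha b hb hab => ?_
    have hstart : ∀ v ∈ insert x S, ¬ G'.ReachableIn Rᶜ a v := fun v hv => hR a ha v hv
    have haS : a ∉ S := fun haS => hstart a (Set.mem_insert_of_mem _ haS) (.refl hab.left_mem)
    have : b ∈ RA ∧ G'.ReachableIn Rᶜ a b := by
      refine hab.induct (P := fun v => v ∈ RA ∧ G'.ReachableIn Rᶜ a v)
        ⟨⟨a, ha, .refl haS⟩, .refl hab.left_mem⟩ ?_
      rintro v w - hw hvw ⟨hv, hav⟩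
      have hvx : v ≠ x := fun h => hstart v (by simp [h]) hav
      have hvy : v ≠ y := fun h => hyRA (h ▸ hv)
      have hvw' : G'.Adj v w := by
        rcases hG v w hvw with h | h
        · exact h
        · rcases Sym2.eq_iff.1 h with h | h
          exacts [absurd h.1 hvx, absurd h.1 hvy]
      have haw := hav.trans (.of_adj hvw' hav.right_mem hw)
      exact ⟨hadjRA v w hv (fun h => hstart w (by simp [h]) haw) hvw', haw⟩
    obtain ⟨a', ha', h⟩ := this.1
    exact hS a' ha' b hb h
  obtain ⟨c, hc, hcv⟩ := hlink.exists_index hX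
  refine ⟨fun v => c v ∩ insert v RA, fun u hu v hv huv =>
    (hc u hu v hv huv).mono Set.inter_subset_left Set.inter_subset_left, fun v hv =>
    ⟨Set.inter_subset_right, ?_⟩⟩
  obtain ⟨a, ha, hav⟩ := hcv v hv
  have hcS : ∀ w ∈ c v, w ∈ S → w = v := by
    intro w hw hwS
    by_contra hne
    obtain ⟨_, _, h⟩ := hcv w (by simp [hwS])
    exact (hc w (by simp [hwS]) v hv hne).ne_of_mem h.right_mem hw rfl
  refine ⟨a, ha, ?_⟩
  by_cases hva : a = v
  · subst hva
    exact .refl ⟨hav.left_mem, by simp⟩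
  obtain ⟨u, w, hau, hw, hwv, huw⟩ := hav.exists_exit (T := {v}ᶜ) hva (by simp)
  obtain rfl : w = v := by simpa using hwv
  have hau' : G'.ReachableIn (c w ∩ insert w RA) a u := by
    refine hau.induct (.refl ⟨hav.left_mem, ?_⟩) ?_
    · exact Or.inr ⟨a, ha, .refl fun h => hva (hcS a hav.left_mem h)⟩
    · rintro p q hp hq hpq hap
      refine hap.trans (.of_adj hpq hap.right_mem ⟨hq.1, Or.inr ?_⟩)
      exact hadjRA p q (hap.right_mem.2.resolve_left hp.right_mem.2)
        (fun h => hq.2 (hcS q hq.1 h)) hpq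
  exact hau'.trans (.of_adj huw hau'.right_mem ⟨hw, by simp⟩)

/-- **Menger's theorem** for finite graphs. -/
theorem linked_of_forall_separates [Finite V] (G : SimpleGraph V) (n : ℕ) :
    ∀ A B : Set V, (∀ X, G.Separates X A B → n ≤ X.ncard) → G.Linked A B n := by
  induction G using WellFoundedLT.induction with
  | ind G ih =>
  intro A B h
  by_cases hbot : G = ⊥
  · subst hbot
    have hn : n ≤ (A ∩ B).ncard := h _ fun a ha b hb hab => by
      have : b = a := hab.induct (P := fun v => v = a) rfl (by simp)
      exact hab.left_mem ⟨ha, this ▸ hb⟩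
    obtain ⟨X, hX, hXn⟩ := Set.exists_subset_card_eq hn
    refine Linked.of_index hXn (fun v => {v}) (by simp) fun v hv =>
      ⟨v, (hX hv).1, v, (hX hv).2, .refl rfl⟩
  obtain ⟨x₀, y₀, hxy₀⟩ : ∃ x y, G.Adj x y := by
    by_contra! hno
    exact hbot (by ext; simp [hno])
  set G' := G.deleteEdges {s(x₀, y₀)} with hG'
  have hle : G' ≤ G := deleteEdges_le _
  have hlt : G' < G := lt_of_le_of_ne hle fun heq => by
    rw [← heq] at hxy₀
    simp [hG'] at hxy₀
  by_cases h' : ∀ X, G'.Separates X A B → n ≤ X.ncard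
  · obtain ⟨c, hc, hcv⟩ := ih G' hlt A B h'
    refine ⟨c, hc, fun i => ?_⟩
    obtain ⟨a, ha, b, hb, hab⟩ := hcv i
    exact ⟨a, ha, b, hb, hab.mono hle subset_rfl⟩
  push Not at h'
  obtain ⟨S, hS, hSn⟩ := h'
  obtain ⟨a₀, ha₀, b₀, hb₀, hab₀⟩ : ∃ a ∈ A, ∃ b ∈ B, G.ReachableIn Sᶜ a b := by
    by_contra! hno
    exact absurd (h S hno) (by omega)
  set RA : Set V := {w | ∃ a ∈ A, G'.ReachableIn Sᶜ a w} with hRA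
  set RB : Set V := {w | ∃ b ∈ B, G'.ReachableIn Sᶜ b w} with hRB
  have hRAB : ∀ w, w ∈ RA → w ∉ RB := by
    rintro w ⟨a, ha, haw⟩ ⟨b, hb, hbw⟩
    exact hS a ha b hb (haw.trans hbw.symm)
  have hadjG : ∀ u v, G.Adj u v → G'.Adj u v ∨ s(u, v) = s(x₀, y₀) := fun u v huv => by
    by_cases h : s(u, v) = s(x₀, y₀)
    · exact Or.inr h
    · exact Or.inl (by rw [hG', deleteEdges_adj]; exact ⟨huv, h⟩)
  -- the ends of the deleted edge, named so that `x` is on the side of `A`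
  obtain ⟨x, y, hxy, hx, hy, hadj⟩ := hab₀.exists_exit (T := RA)
    ⟨a₀, ha₀, .refl hab₀.left_mem⟩ (fun h => hRAB _ h ⟨b₀, hb₀, .refl hab₀.right_mem⟩)
  have hxRA : x ∈ RA := hxy.right_mem.2
  have hexy : s(x, y) = s(x₀, y₀) := (hadjG x y hadj).resolve_left fun h => by
    obtain ⟨a, ha, hax⟩ := hxRA
    exact hy ⟨a, ha, hax.trans (.of_adj h hax.right_mem hx)⟩
  rw [← hexy] at hadjG
  have hyRB : y ∈ RB := by
    obtain ⟨u, w, hu, hwS, hw, huw⟩ := hab₀.symm.exists_exit (T := RB)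
      ⟨b₀, hb₀, .refl hab₀.right_mem⟩ (hRAB _ ⟨a₀, ha₀, .refl hab₀.left_mem⟩)
    have huRB : u ∈ RB := hu.right_mem.2
    have := (hadjG u w huw).resolve_left fun h => by
      obtain ⟨b, hb, hbu⟩ := huRB
      exact hw ⟨b, hb, hbu.trans (.of_adj h hbu.right_mem hwS)⟩
    rcases Sym2.eq_iff.1 this with h | h
    · exact absurd (h.1 ▸ huRB) (hRAB x hxRA)
    · exact h.1 ▸ huRB
  have hxS : x ∉ S := by
    obtain ⟨a, ha, hax⟩ := hxRA
    exact hax.right_mem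
  have hXcard : (insert x S).ncard = S.ncard + 1 := Set.ncard_insert_of_notMem hxS
  have hYcard : (insert y S).ncard = S.ncard + 1 := Set.ncard_insert_of_notMem hx
  have hXn : n ≤ (insert x S).ncard := h _ fun a ha b hb hab => by
    have haS : a ∉ S := fun h => hab.left_mem (by simp [h])
    have : b ∈ RA := by
      refine hab.induct (P := (· ∈ RA)) ⟨a, ha, .refl haS⟩ ?_
      rintro p q hp hq hpq ⟨a', ha', hap⟩
      have hpx : p ≠ x := fun h => hp.right_mem (by simp [h])
      have hpy : p ≠ y := fun h => hy ⟨a', ha', h ▸ hap⟩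
      have := (hadjG p q hpq).resolve_right fun h => by
        rcases Sym2.eq_iff.1 h with h | h
        exacts [hpx h.1, hpy h.1]
      exact ⟨a', ha', hap.trans (.of_adj this hap.right_mem fun h => hq (by simp [h]))⟩
    exact hRAB b this ⟨b, hb, .refl fun h => hab.right_mem (by simp [h])⟩
  have hn : S.ncard + 1 = n := by omega
  obtain ⟨cA, hcA, hcA'⟩ := exists_half_linkage hadjG (ih G' hlt) h hS
    (hXcard.trans hn) hxRA (fun a ha h => hy ⟨a, ha, h⟩)
  obtain ⟨cB, hcB, hcB'⟩ := exists_half_linkage (x := y) (y := x)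
    (by simpa only [Sym2.eq_swap (a := y)] using hadjG) (ih G' hlt)
    (fun X hX => h X hX.symm) hS.symm (hYcard.trans hn) hyRB
    (fun b hb h => hRAB x hxRA ⟨b, hb, h⟩)
  classical
  -- `φ` matches the end of a connection from `A` with the end of one from `B`
  let φ : V → V := fun v => if v = x then y else v
  have hφx : φ x = y := if_pos rfl
  have hφ : ∀ v ∈ S, φ v = v := fun v hv => if_neg (by rintro rfl; exact hxS hv)
  have hφY : ∀ v ∈ insert x S, φ v ∈ insert y S := by
    rintro v (rfl | hv)
    · simp [hφx]
    · simp [hφ v hv, hv]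
  have hSRA : ∀ v ∈ S, v ∉ RA := fun v hv ⟨a, _, h⟩ => h.right_mem hv
  have hSRB : ∀ v ∈ S, v ∉ RB := fun v hv ⟨a, _, h⟩ => h.right_mem hv
  have hYRA : ∀ v ∈ insert y S, v ∉ RA := by
    rintro v (rfl | hv)
    exacts [hy, hSRA v hv]
  have hXRB : ∀ v ∈ insert x S, v ∉ RB := by
    rintro v (rfl | hv)
    exacts [hRAB _ hxRA, hSRB v hv]
  have hne : x ≠ y := hadj.ne
  have hφu : ∀ u ∈ insert x S, ∀ v ∈ insert x S, u = φ v → u = v := by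
    rintro u hu v (rfl | hv) huv
    · rw [hφx] at huv
      subst huv
      exact absurd hyRB (hXRB _ hu)
    · rwa [hφ v hv] at huv
  have hcross : ∀ u ∈ insert x S, ∀ v ∈ insert x S, u ≠ v → Disjoint (cA u) (cB (φ v)) := by
    intro u hu v hv huv
    refine Set.disjoint_left.2 fun w hw hw' => ?_
    rcases (hcA' u hu).1 hw with rfl | hwA
    · rcases (hcB' _ (hφY v hv)).1 hw' with h | hwB
      · exact huv (hφu _ hu v hv h)
      · exact hXRB _ hu hwB
    · rcases (hcB' _ (hφY v hv)).1 hw' with rfl | hwB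
      · exact hYRA _ (hφY v hv) hwA
      · exact hRAB w hwA hwB
  have hφinj : ∀ u ∈ insert x S, ∀ v ∈ insert x S, u ≠ v → φ u ≠ φ v := by
    rintro u (rfl | hu) v (rfl | hv) huv
    · exact absurd rfl huv
    · rw [hφx, hφ v hv]; exact fun h => hx (h ▸ hv)
    · rw [hφx, hφ u hu]; exact fun h => hx (h ▸ hu)
    · rwa [hφ u hu, hφ v hv]
  refine Linked.of_index (hXcard.trans hn) (fun v => cA v ∪ cB (φ v)) ?_ ?_
  · intro u hu v hv huv
    refine Set.disjoint_union_left.2 ⟨Set.disjoint_union_right.2 ⟨hcA u hu v hv huv,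
      hcross u hu v hv huv⟩, Set.disjoint_union_right.2 ⟨(hcross v hv u hu huv.symm).symm,
      hcB _ (hφY u hu) _ (hφY v hv) (hφinj u hu v hv huv)⟩⟩
  · intro v hv
    obtain ⟨-, a, ha, hav⟩ := hcA' v hv
    obtain ⟨-, b, hb, hbv⟩ := hcB' _ (hφY v hv)
    refine ⟨a, ha, b, hb, (hav.mono hle Set.subset_union_left).trans (.trans ?_
      (hbv.symm.mono hle Set.subset_union_right))⟩
    rcases hv with rfl | hvS
    · rw [hφx] at hbv ⊢
      exact .of_adj hadj (Or.inl hav.right_mem) (Or.inr hbv.right_mem)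
    · rw [hφ v hvS]
      exact .refl (Or.inl hav.right_mem)

/-- A walk from `A` to `B` inside `S` contains an `A`-`B` path. -/
theorem ReachableIn.exists_isSetPath {G : SimpleGraph V} {S A B : Set V} {a b : V}
    (h : G.ReachableIn S a b) (ha : a ∈ A) (hb : b ∈ B) :
    ∃ (a' b' : V) (p : G.Walk a' b'), IsSetPath A B p ∧ ∀ c ∈ p.support, c ∈ S := by
  classical
  -- a shortest walk from `A` to `B` inside `S`
  let P : ℕ → Prop := fun n => ∃ (a' b' : V) (p : G.Walk a' b'),
    a' ∈ A ∧ b' ∈ B ∧ (∀ c ∈ p.support, c ∈ S) ∧ p.length = n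
  have hP : ∃ n, P n := by
    obtain ⟨w, hw⟩ := h
    exact ⟨_, a, b, w, ha, hb, hw, rfl⟩
  obtain ⟨a', b', p, ha', hb', hp, hlen⟩ := Nat.find_spec hP
  have hmin : ∀ (c d : V) (q : G.Walk c d), c ∈ A → d ∈ B → (∀ e ∈ q.support, e ∈ S) →
      p.length ≤ q.length := fun c d q hc hd hq =>
    hlen ▸ Nat.find_min' hP ⟨c, d, q, hc, hd, hq, rfl⟩
  refine ⟨a', b', p, ⟨?_, ha', hb', ?_⟩, hp⟩
  · have hle := hmin _ _ p.bypass ha' hb' fun e he => hp e (p.support_bypass_subset_support he)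
    rw [← p.bypass_eq_self_of_length_le_length_bypass hle]
    exact p.bypass_isPath
  · rintro w hw hwa hwb (hwA | hwB)
    · have := hmin _ _ (p.dropUntil w hw) hwA hb'
        fun e he => hp e (p.support_dropUntil_subset_support hw he)
      have h2 : (p.takeUntil w hw).length + (p.dropUntil w hw).length = p.length := by
        rw [← Walk.length_append, p.take_spec hw]
      have h3 : (p.takeUntil w hw).length = 0 := by omega
      exact hwa (Walk.eq_of_length_eq_zero h3).symm
    · have := hmin _ _ (p.takeUntil w hw) ha' hwB
        fun e he => hp e (p.support_takeUntil_subset_support hw he)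
      have h2 : (p.takeUntil w hw).length + (p.dropUntil w hw).length = p.length := by
        rw [← Walk.length_append, p.take_spec hw]
      have h3 : (p.dropUntil w hw).length = 0 := by omega
      exact hwb (Walk.eq_of_length_eq_zero h3)

theorem Linked.hasDisjointSetPaths {V : Type u} {G : SimpleGraph V} {A B : Set V} {n : ℕ}
    (h : G.Linked A B n) : G.HasDisjointSetPaths A B n := by
  obtain ⟨c, hc, h⟩ := h
  have : ∀ i, ∃ (a' b' : V) (p : G.Walk a' b'), IsSetPath A B p ∧ ∀ x ∈ p.support, x ∈ c i := by
    intro i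
    obtain ⟨a, ha, b, hb, hab⟩ := h i
    exact hab.exists_isSetPath ha hb
  choose a b p hp hpc using this
  refine ⟨a, b, p, hp, fun i j hij x hx hx' => ?_⟩
  exact (hc hij).ne_of_mem (hpc i x hx) (hpc j x hx') rfl

/-! ### Connected node sets of a tree -/

section Tree

variable {N : Type*} {T : SimpleGraph N}

/-- Any two elements of `S` are joined by a walk inside `S`. -/
def ConnectedOn (T : SimpleGraph N) (S : Set N) : Prop :=
  ∀ a ∈ S, ∀ b ∈ S, T.ReachableIn S a b

theorem IsAcyclic.mem_of_reachableIn (hT : T.IsAcyclic) {S : Set N} {a b c : N}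
    (h : T.ReachableIn S a b) (p : T.Walk a b) (hp : p.IsPath) (hc : c ∈ p.support) : c ∈ S := by
  classical
  obtain ⟨w, hw⟩ := h
  have : (⟨p, hp⟩ : T.Path a b) = w.toPath := (hT.subsingleton_path a b).elim _ _
  have hpw : p = w.toPath := congrArg Subtype.val this
  rw [hpw] at hc
  exact hw c (w.support_toPath_subset_support hc)

theorem Connected.exists_path (hT : T.Connected) (a b : N) : ∃ p : T.Walk a b, p.IsPath := by
  classical
  obtain ⟨w⟩ := hT.preconnected a b
  exact ⟨w.bypass, w.bypass_isPath⟩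

/-- In a tree, walks inside two sets yield a walk inside their intersection. -/
theorem IsTree.reachableIn_inter (hT : T.IsTree) {S S' : Set N} {a b : N}
    (h : T.ReachableIn S a b) (h' : T.ReachableIn S' a b) : T.ReachableIn (S ∩ S') a b := by
  obtain ⟨p, hp⟩ := hT.1.exists_path a b
  exact ⟨p, fun c hc => ⟨hT.2.mem_of_reachableIn h p hp hc, hT.2.mem_of_reachableIn h' p hp hc⟩⟩

theorem IsTree.connectedOn_inter (hT : T.IsTree) {S S' : Set N} (h : T.ConnectedOn S)
    (h' : T.ConnectedOn S') : T.ConnectedOn (S ∩ S') :=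
  fun a ha b hb => hT.reachableIn_inter (h a ha.1 b hb.1) (h' a ha.2 b hb.2)

/-- Three connected node sets of a tree that meet pairwise have a common element. -/
theorem IsTree.exists_mem_three (hT : T.IsTree) {S₁ S₂ S₃ : Set N} (h₁ : T.ConnectedOn S₁)
    (h₂ : T.ConnectedOn S₂) (h₃ : T.ConnectedOn S₃) (h₁₂ : (S₁ ∩ S₂).Nonempty)
    (h₂₃ : (S₂ ∩ S₃).Nonempty) (h₁₃ : (S₁ ∩ S₃).Nonempty) : ∃ t, t ∈ S₁ ∧ t ∈ S₂ ∧ t ∈ S₃ := by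
  obtain ⟨a, ha₁, ha₂⟩ := h₁₂
  obtain ⟨b, hb₂, hb₃⟩ := h₂₃
  obtain ⟨c, hc₁, hc₃⟩ := h₁₃
  by_contra! hno
  have haS : a ∉ S₃ := hno a ha₁ ha₂
  -- A walk inside `S₁` and one inside `S₂` lead from `a` to `S₃`. They enter it through distinct
  -- nodes `y` and `y'`, coming from `x` and `x'`.
  obtain ⟨x, y, hx, hy₁, hy₃, hxy⟩ := (h₁ a ha₁ c hc₁).exists_exit (T := S₃ᶜ) haS (by simpa)
  obtain ⟨x', y', hx', hy₂', hy₃', hxy'⟩ :=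
    (h₂ a ha₂ b hb₂).exists_exit (T := S₃ᶜ) haS (by simpa)
  simp only [Set.mem_compl_iff, not_not] at hy₃ hy₃'
  have hxx' : T.ReachableIn S₃ᶜ x' x := (hx'.symm.mono le_rfl Set.inter_subset_right).trans
    (hx.mono le_rfl Set.inter_subset_right)
  have hyy' : T.ReachableIn S₃ y' y := h₃ _ hy₃' _ hy₃
  have hyne : y ≠ y' := fun h => hno y hy₁ (h ▸ hy₂') hy₃
  -- Both the walk through `x'` outside `S₃` and the path inside `S₃` to `y` and on to `x` lead
  -- from `y'` to `x`, which is impossible in a tree since the former avoids `y`.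
  have h : T.ReachableIn (insert y' S₃ᶜ) y' x :=
    (ReachableIn.of_adj hxy'.symm (by simp) (Or.inr hxx'.left_mem)).trans
      (hxx'.mono le_rfl (Set.subset_insert _ _))
  obtain ⟨q, hq⟩ := hT.1.exists_path y' y
  have hqS : ∀ c ∈ q.support, c ∈ S₃ := fun c hc => hT.2.mem_of_reachableIn hyy' q hq hc
  have hq' : (q.concat hxy.symm).IsPath := hq.concat (fun h => hx.right_mem.2 (hqS _ h)) _
  rcases hT.2.mem_of_reachableIn h _ hq' (c := y) (by simp [Walk.support_concat]) with h | h
  exacts [hyne h, h hy₃]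

/-- The **Helly property** of subtrees. -/
theorem IsTree.helly (hT : T.IsTree) {ι : Type*} (S : ι → Set N) (hS : ∀ i, T.ConnectedOn (S i))
    (I : Finset ι) (hmeet : ∀ i ∈ I, ∀ j ∈ I, (S i ∩ S j).Nonempty) :
    ∀ R : Set N, T.ConnectedOn R → R.Nonempty → (∀ i ∈ I, (R ∩ S i).Nonempty) →
      ∃ t ∈ R, ∀ i ∈ I, t ∈ S i := by
  classical
  induction I using Finset.induction_on with
  | empty => exact fun R _ ⟨t, ht⟩ _ => ⟨t, ht, by simp⟩
  | insert i I hi ih =>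
    intro R hR _ hRS
    obtain ⟨t, ht, htI⟩ := ih (fun j hj l hl => hmeet j (by simp [hj]) l (by simp [hl]))
      (R ∩ S i) (hT.connectedOn_inter hR (hS i)) (hRS i (by simp)) fun j hj => by
        obtain ⟨t, h1, h2, h3⟩ := hT.exists_mem_three hR (hS i) (hS j) (hRS i (by simp))
          (hmeet i (by simp) j (by simp [hj])) (hRS j (by simp [hj]))
        exact ⟨t, ⟨h1, h2⟩, h3⟩
    refine ⟨t, ht.1, fun j hj => ?_⟩
    rcases Finset.mem_insert.1 hj with rfl | hj
    exacts [ht.2, htI j hj]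

/-- A path that has left its first node avoids it from then on. -/
theorem Walk.IsPath.reachableIn_compl_start {a b c : N} {p : T.Walk a b} (hp : p.IsPath)
    (hc : c ∈ p.support) (hca : c ≠ a) : T.ReachableIn {a}ᶜ c b := by
  classical
  refine ⟨p.dropUntil c hc, fun d hd hda => ?_⟩
  obtain rfl : d = a := hda
  have h := p.take_spec hc
  rw [← h, Walk.isPath_def, Walk.support_append] at hp
  have hd' : d ∈ (p.dropUntil c hc).support.tail := by
    rw [Walk.mem_support_iff] at hd
    exact hd.resolve_left hca.symm
  exact (List.nodup_append.1 hp).2.2 d (Walk.start_mem_support _) d hd' rfl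

/-- Of two adjacent nodes, one is separated by the other from any given node. -/
theorem Connected.reachableIn_compl_or (hT : T.Connected) {t t' : N} (h : t ≠ t') (r : N) :
    T.ReachableIn {t}ᶜ t' r ∨ T.ReachableIn {t'}ᶜ t r := by
  obtain ⟨p, hp⟩ := hT.exists_path t r
  by_cases ht' : t' ∈ p.support
  · exact Or.inl (hp.reachableIn_compl_start ht' h.symm)
  · exact Or.inr ⟨p, fun c hc hct => ht' (by rwa [← Set.mem_singleton_iff.1 hct])⟩

/-- In a tree, a node has at most one neighbour on each of its sides. -/
theorem IsTree.eq_of_adj_of_reachableIn (hT : T.IsTree) {t x y : N} (hx : T.Adj t x)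
    (hy : T.Adj t y) (h : T.ReachableIn {t}ᶜ x y) : x = y := by
  by_contra hne
  have hp : (Walk.cons hx.symm (Walk.cons hy .nil)).IsPath := by
    simp [Walk.cons_isPath_iff, hx.ne', hy.ne, hne]
  exact hT.2.mem_of_reachableIn h _ hp (c := t) (by simp) rfl

end Tree

namespace TreeDecomposition

/-! ### Tree-decompositions as families of subtrees -/

variable {V : Type u} {G : SimpleGraph V} (D : TreeDecomposition G)

/-- The nodes whose parts contain a given vertex. -/
def nodes (v : V) : Set D.Node := {t | v ∈ D.part t}

theorem connectedOn_nodes (v : V) : D.tree.ConnectedOn (D.nodes v) := by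
  intro a ha b hb
  obtain ⟨p, hp⟩ := D.isTree.1.exists_path a b
  exact ⟨p, fun c hc => D.inter_subset a c b p hp hc ⟨ha, hb⟩⟩

theorem exists_mem_part (v : V) : ∃ t, v ∈ D.part t := by
  have : v ∈ ⋃ t, D.part t := D.iUnion_part ▸ Set.mem_univ v
  simpa using this

/-- The separator of the separation induced by an edge of the tree is its adhesion set. -/
theorem side_inter_side {t t' : D.Node} (h : D.tree.Adj t t') :
    D.side t t' ∩ D.side t' t = D.part t ∩ D.part t' := by
  have hbridge : ¬ (D.tree.deleteEdges {s(t, t')}).Reachable t t' := by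
    have := isAcyclic_iff_forall_adj_isBridge.1 D.isTree.2 h
    exact isBridge_iff.1 this
  ext v
  simp only [side, Set.mem_inter_iff, Set.mem_iUnion, Set.mem_ofPred_eq, exists_prop]
  constructor
  · rintro ⟨⟨s, hs, hvs⟩, s', hs', hvs'⟩
    rw [Sym2.eq_swap] at hs'
    obtain ⟨x, y, hx, hy, hyT, hxy⟩ := (D.connectedOn_nodes v s hvs s' hvs').exists_exit
      (T := {s | (D.tree.deleteEdges {s(t, t')}).Reachable t s}) hs
      (fun h => hbridge (h.trans hs'.symm))
    have hxv := hx.right_mem.1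
    have he : s(x, y) = s(t, t') := by
      by_contra hne
      refine hyT (hx.right_mem.2.trans (Adj.reachable ?_))
      rw [deleteEdges_adj]
      exact ⟨hxy, hne⟩
    rcases Sym2.eq_iff.1 he with ⟨rfl, rfl⟩ | ⟨rfl, rfl⟩
    exacts [⟨hxv, hy⟩, ⟨hy, hxv⟩]
  · rintro ⟨h1, h2⟩
    exact ⟨⟨t, .refl _, h1⟩, t', .refl _, h2⟩

theorem sepOrder_eq {t t' : D.Node} (h : D.tree.Adj t t') :
    D.sepOrder t t' = (D.part t ∩ D.part t').encard := by
  rw [sepOrder, D.side_inter_side h]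

end TreeDecomposition

/-! ### Separations that witness a failure of leanness -/

/-- `(A, B)` is a separation of `G`: every vertex and every edge lies in `A` or in `B`. -/
structure IsSeparation {V : Type*} (G : SimpleGraph V) (A B : Set V) : Prop where
  mem_or : ∀ v, v ∈ A ∨ v ∈ B
  adj : ∀ a b, G.Adj a b → (a ∈ A ∧ b ∈ A) ∨ (a ∈ B ∧ b ∈ B)

namespace IsSeparation

variable {V : Type*} {G : SimpleGraph V} {A B C E : Set V}

theorem symm (h : G.IsSeparation A B) : G.IsSeparation B A :=
  ⟨fun v => (h.mem_or v).symm, fun a b hab => (h.adj a b hab).symm⟩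

theorem corner (h : G.IsSeparation A B) (h' : G.IsSeparation C E) :
    G.IsSeparation (A ∪ C) (B ∩ E) := by
  refine ⟨fun v => ?_, fun a b hab => ?_⟩
  · have := h.mem_or v
    have := h'.mem_or v
    simp only [Set.mem_union, Set.mem_inter_iff]
    tauto
  · have := h.adj a b hab
    have := h'.adj a b hab
    simp only [Set.mem_union, Set.mem_inter_iff]
    tauto

theorem corner_inter (h : G.IsSeparation A B) :
    (A ∪ C) ∩ (B ∩ E) = ((A ∩ B) ∩ E) ∪ ((C ∩ E) \ A) := by
  ext v
  have := h.mem_or v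
  simp only [Set.mem_union, Set.mem_inter_iff, Set.mem_sdiff]
  tauto

theorem ncard_corner [Finite V] (h : G.IsSeparation A B) :
    ((A ∪ C) ∩ (B ∩ E)).ncard = ((A ∩ B) ∩ E).ncard + ((C ∩ E) \ A).ncard := by
  rw [h.corner_inter, Set.ncard_union_eq]
  exact Set.disjoint_left.2 fun v hv hv' => hv'.2 hv.1.1

end IsSeparation

namespace TreeDecomposition

variable {V : Type u} {G : SimpleGraph V} (D : TreeDecomposition G)

/-- The edges of the decomposition tree whose adhesion sets have more than `m` elements. -/
def thick (m : ℕ) : SimpleGraph D.Node where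
  Adj t t' := D.tree.Adj t t' ∧ m < (D.part t ∩ D.part t').ncard
  symm := ⟨fun t t' h => ⟨h.1.symm, by rw [Set.inter_comm]; exact h.2⟩⟩
  loopless := ⟨fun t h => h.1.ne rfl⟩

theorem thick_le (m : ℕ) : D.thick m ≤ D.tree := fun _ _ h => h.1

theorem thick_anti {m n : ℕ} (h : m ≤ n) : D.thick n ≤ D.thick m :=
  fun _ _ h' => ⟨h'.1, h.trans_lt h'.2⟩

/-- A separation `(A, B)` and two nodes that witness a failure of leanness: the parts at the two
nodes have more than `|A ∩ B|` vertices in `A` and in `B`, respectively, and all adhesion sets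
between the two nodes have more than `|A ∩ B|` elements. -/
structure Bad (A B : Set V) (t₁ t₂ : D.Node) : Prop where
  sep : G.IsSeparation A B
  left : (A ∩ B).ncard < (D.part t₁ ∩ A).ncard
  right : (A ∩ B).ncard < (D.part t₂ ∩ B).ncard
  reach : (D.thick (A ∩ B).ncard).Reachable t₁ t₂

/-- The nodes on the path of the tree between `t₁` and `t₂`, that is, those which all walks between
`t₁` and `t₂` contain. -/
def between (t₁ t₂ : D.Node) : Set D.Node := {p | ¬ D.tree.ReachableIn {p}ᶜ t₁ t₂}

/-- The distance in the tree between the nodes whose parts contain `x` and the path between `t₁`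
and `t₂`. -/
noncomputable def distToPath (t₁ t₂ : D.Node) (x : V) : ℕ :=
  sInf {n | ∃ s p, x ∈ D.part s ∧ p ∈ D.between t₁ t₂ ∧ ∃ w : D.tree.Walk s p, w.length = n}

theorem between_comm (t₁ t₂ : D.Node) : D.between t₁ t₂ = D.between t₂ t₁ := by
  ext p
  exact not_congr ⟨fun h => h.symm, fun h => h.symm⟩

/-- A bad tuple that is minimal in three respects, in order of precedence: the order of the
separation, the distance of the two nodes, and the total distance of the separator from the path
between the two nodes. -/
structure MinBad (A B : Set V) (t₁ t₂ : D.Node) : Prop extends D.Bad A B t₁ t₂ where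
  le_order : ∀ A' B' t₁' t₂', D.Bad A' B' t₁' t₂' → (A ∩ B).ncard ≤ (A' ∩ B').ncard
  le_dist : ∀ A' B' t₁' t₂', D.Bad A' B' t₁' t₂' → (A' ∩ B').ncard = (A ∩ B).ncard →
    D.tree.dist t₁ t₂ ≤ D.tree.dist t₁' t₂'
  le_sum : ∀ A' B', D.Bad A' B' t₁ t₂ → (A' ∩ B').ncard = (A ∩ B).ncard →
    ∑ᶠ x ∈ A ∩ B, D.distToPath t₁ t₂ x ≤ ∑ᶠ x ∈ A' ∩ B', D.distToPath t₁ t₂ x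

variable {D}

theorem Bad.symm {A B : Set V} {t₁ t₂ : D.Node} (h : D.Bad A B t₁ t₂) : D.Bad B A t₂ t₁ where
  sep := h.sep.symm
  left := by rw [Set.inter_comm B]; exact h.right
  right := by rw [Set.inter_comm B]; exact h.left
  reach := by rw [Set.inter_comm B]; exact h.reach.symm

theorem MinBad.symm {A B : Set V} {t₁ t₂ : D.Node} (h : D.MinBad A B t₁ t₂) :
    D.MinBad B A t₂ t₁ where
  toBad := h.toBad.symm
  le_order := fun A' B' t₁' t₂' h' => by rw [Set.inter_comm B]; exact h.le_order _ _ _ _ h'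
  le_dist := fun A' B' t₁' t₂' h' => by
    rw [Set.inter_comm B, dist_comm]
    exact h.le_dist _ _ _ _ h'
  le_sum := fun A' B' h' heq => by
    have := h.le_sum B' A' h'.symm (by rw [Set.inter_comm B', heq, Set.inter_comm])
    rw [Set.inter_comm B, Set.inter_comm A']
    unfold distToPath at this ⊢
    rwa [between_comm D t₂ t₁]

theorem Bad.exists_minBad {A B : Set V} {t₁ t₂ : D.Node} (h : D.Bad A B t₁ t₂) :
    ∃ A' B' t₁' t₂', D.MinBad A' B' t₁' t₂' ∧ (A' ∩ B').ncard ≤ (A ∩ B).ncard := by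
  let μ : Set V × Set V × D.Node × D.Node → ℕ ×ₗ ℕ ×ₗ ℕ := fun x =>
    toLex ((x.1 ∩ x.2.1).ncard, toLex (D.tree.dist x.2.2.1 x.2.2.2,
      ∑ᶠ v ∈ x.1 ∩ x.2.1, D.distToPath x.2.2.1 x.2.2.2 v))
  obtain ⟨⟨A', B', t₁', t₂'⟩, hx, hmin⟩ := (InvImage.wf μ wellFounded_lt).has_min
    {x | D.Bad x.1 x.2.1 x.2.2.1 x.2.2.2} ⟨(A, B, t₁, t₂), h⟩
  have hle : ∀ A'' B'' t₁'' t₂'', D.Bad A'' B'' t₁'' t₂'' →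
      (A' ∩ B').ncard ≤ (A'' ∩ B'').ncard := fun A'' B'' t₁'' t₂'' h'' => by
    by_contra! hlt
    exact hmin (A'', B'', t₁'', t₂'') h'' (Prod.Lex.toLex_lt_toLex.2 (Or.inl hlt))
  refine ⟨A', B', t₁', t₂', ⟨hx, hle, ?_, ?_⟩, hle _ _ _ _ h⟩
  · intro A'' B'' t₁'' t₂'' h'' heq
    by_contra! hlt
    exact hmin (A'', B'', t₁'', t₂'') h'' (Prod.Lex.toLex_lt_toLex.2 (Or.inr ⟨heq,
      Prod.Lex.toLex_lt_toLex.2 (Or.inl hlt)⟩))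
  · intro A'' B'' h'' heq
    by_contra! hlt
    exact hmin (A'', B'', t₁', t₂') h'' (Prod.Lex.toLex_lt_toLex.2 (Or.inr ⟨heq,
      Prod.Lex.toLex_lt_toLex.2 (Or.inr ⟨rfl, hlt⟩)⟩))

/-! ### Uncrossing a minimal bad separation with the tree-decomposition -/

section Uncross

variable {A B C E : Set V} {t₁ t₂ t t' : D.Node}

theorem Bad.corner [Finite V] (h : D.Bad A B t₁ t₂) (hCE : G.IsSeparation C E) (hE : D.part t₂ ⊆ E)
    (hle : ((A ∪ C) ∩ (B ∩ E)).ncard ≤ (A ∩ B).ncard) : D.Bad (A ∪ C) (B ∩ E) t₁ t₂ where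
  sep := h.sep.corner hCE
  left := hle.trans_lt (h.left.trans_le (Set.ncard_le_ncard (by
    rw [Set.inter_union_distrib_left]; exact Set.subset_union_left)))
  right := by
    have : D.part t₂ ∩ (B ∩ E) = D.part t₂ ∩ B := by
      rw [← Set.inter_assoc, Set.inter_right_comm, Set.inter_eq_left.2 hE]
    rw [this]
    exact hle.trans_lt h.right
  reach := h.reach.mono (D.thick_anti hle)

theorem ncard_inter_split [Finite V] (X E : Set V) : (X ∩ E).ncard + (X \ E).ncard = X.ncard :=
  Set.ncard_inter_add_ncard_sdiff_eq_ncard X E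

/-- The vertices of the separator beyond a separation `(C, E)` are at most as many as the vertices
of `C ∩ E` outside `A`: replacing the former by the latter does not lower the order. -/
theorem MinBad.uncross [Finite V] (h : D.MinBad A B t₁ t₂) (hCE : G.IsSeparation C E)
    (hE : D.part t₂ ⊆ E) : ((A ∩ B) \ E).ncard ≤ ((C ∩ E) \ A).ncard := by
  by_contra! hlt
  have h1 := ncard_inter_split (A ∩ B) E
  have h2 := h.sep.ncard_corner (C := C) (E := E)
  have := h.le_order _ _ _ _ (h.toBad.corner hCE hE (by omega))
  omega

variable (D) in
/-- The union of the parts at the nodes that `t` separates from `r`. -/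
def behind (t r : D.Node) : Set V := {v | ∃ s, v ∈ D.part s ∧ ¬ D.tree.ReachableIn {t}ᶜ s r}

variable (D) in
/-- The union of the parts at the nodes that `t` does not separate from `r`. -/
def before (t r : D.Node) : Set V := {v | ∃ s, v ∈ D.part s ∧ D.tree.ReachableIn {t}ᶜ s r}

theorem part_subset_behind (t r : D.Node) : D.part t ⊆ D.behind t r :=
  fun _ hv => ⟨t, hv, fun h => h.left_mem rfl⟩

theorem isSeparation_behind {t r : D.Node} {F : Set V} (hF : D.before t r ⊆ F) :
    G.IsSeparation (D.behind t r) F := by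
  refine ⟨fun v => ?_, fun a b hab => ?_⟩
  · obtain ⟨s, hs⟩ := D.exists_mem_part v
    by_cases h : D.tree.ReachableIn {t}ᶜ s r
    · exact Or.inr (hF ⟨s, hs, h⟩)
    · exact Or.inl ⟨s, hs, h⟩
  · obtain ⟨s, ha, hb⟩ := D.exists_part_of_adj a b hab
    by_cases h : D.tree.ReachableIn {t}ᶜ s r
    · exact Or.inr ⟨hF ⟨s, ha, h⟩, hF ⟨s, hb, h⟩⟩
    · exact Or.inl ⟨⟨s, ha, h⟩, ⟨s, hb, h⟩⟩

theorem exists_adj_of_mem_behind_of_mem_before {t r : D.Node} {v : V} (h : v ∈ D.behind t r)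
    (h' : v ∈ D.before t r) :
    v ∈ D.part t ∧ ∃ x, D.tree.Adj t x ∧ D.tree.ReachableIn {t}ᶜ x r ∧ v ∈ D.part x := by
  obtain ⟨s, hs, hsr⟩ := h
  obtain ⟨s', hs', hsr'⟩ := h'
  obtain ⟨x, y, hx, hy, hyT, hxy⟩ := (D.connectedOn_nodes v s' hs' s hs).exists_exit
    (T := {s | D.tree.ReachableIn {t}ᶜ s r}) hsr' hsr
  have hxr : D.tree.ReachableIn {t}ᶜ x r := hx.right_mem.2
  have hyt : y = t := by
    by_contra hne
    exact hyT ((ReachableIn.of_adj hxy.symm hne hxr.left_mem).trans hxr)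
  subst hyt
  exact ⟨hy, x, hxy.symm, hxr, hx.right_mem.1⟩

theorem behind_inter_before_subset (hadj : D.tree.Adj t t') {r : D.Node}
    (h : D.tree.ReachableIn {t}ᶜ t' r) :
    D.behind t r ∩ D.before t r ⊆ D.part t ∩ D.part t' := by
  rintro v ⟨hv, hv'⟩
  obtain ⟨h1, x, hx, hxr, hvx⟩ := exists_adj_of_mem_behind_of_mem_before hv hv'
  rw [D.isTree.eq_of_adj_of_reachableIn hadj hx (h.trans hxr.symm)]
  exact ⟨h1, hvx⟩

theorem behind_inter_union_before (t r : D.Node) :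
    D.behind t r ∩ (D.part t ∪ D.before t r) = D.part t := by
  refine Set.Subset.antisymm ?_ fun v hv => ⟨part_subset_behind t r hv, Or.inl hv⟩
  rintro v ⟨hv, hv' | hv'⟩
  exacts [hv', (exists_adj_of_mem_behind_of_mem_before hv hv').1]

theorem part_subset_union_before (t r : D.Node) : D.part r ⊆ D.part t ∪ D.before t r := by
  intro v hv
  by_cases h : r = t
  · exact Or.inl (h ▸ hv)
  · exact Or.inr ⟨r, hv, .refl h⟩

theorem Bad.lt_ncard_part [Finite V] (h : D.Bad A B t₁ t₂) (ht : (D.thick (A ∩ B).ncard).Reachable t₁ t) :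
    (A ∩ B).ncard < (D.part t).ncard := by
  obtain ⟨w⟩ := ht
  cases w using Walk.concatRec with
  | Hnil => exact h.left.trans_le (Set.ncard_le_ncard Set.inter_subset_left)
  | Hconcat w hadj => exact hadj.2.trans_le (Set.ncard_le_ncard Set.inter_subset_right)

theorem Bad.reachable_of_mem_between (h : D.Bad A B t₁ t₂) (ht : t ∈ D.between t₁ t₂) :
    (D.thick (A ∩ B).ncard).Reachable t₁ t := by
  classical
  obtain ⟨w⟩ := h.reach
  have : t ∈ w.support := by
    by_contra hno
    refine ht ⟨w.mapLe (D.thick_le _), fun c hc hct => hno ?_⟩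
    rw [Walk.support_mapLe_eq_support] at hc
    rwa [← Set.mem_singleton_iff.1 hct]
  exact ⟨w.takeUntil t this⟩

theorem left_mem_between (t₁ t₂ : D.Node) : t₁ ∈ D.between t₁ t₂ := fun h => h.left_mem rfl

theorem dist_lt_of_mem_between (ht : t ∈ D.between t₁ t₂) (hne : t ≠ t₁) :
    D.tree.dist t t₂ < D.tree.dist t₁ t₂ := by
  classical
  obtain ⟨w, hw⟩ := D.isTree.1.exists_walk_length_eq_dist t₁ t₂
  have hmem : t ∈ w.support := by
    by_contra hno
    exact ht ⟨w, fun c hc hct => hno (by rwa [← Set.mem_singleton_iff.1 hct])⟩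
  have h1 : (w.takeUntil t hmem).length + (w.dropUntil t hmem).length = w.length := by
    rw [← Walk.length_append, w.take_spec hmem]
  have h2 : (w.takeUntil t hmem).length ≠ 0 := fun h =>
    hne (Walk.eq_of_length_eq_zero h).symm
  have h3 := dist_le (w.dropUntil t hmem)
  omega

/-- A node that is off the path between `t₁` and `t₂`, or equal to `t₁`, does not separate the
rest of the path from `t₂`. -/
theorem reachableIn_of_mem_between {p : D.Node} (hp : p ∈ D.between t₁ t₂) (hpt : p ≠ t)
    (ht : t ∈ D.between t₁ t₂ → t = t₁) : D.tree.ReachableIn {t}ᶜ p t₂ := by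
  by_cases htb : t ∈ D.between t₁ t₂
  · obtain rfl := ht htb
    obtain ⟨w, hw⟩ := D.isTree.1.exists_path t t₂
    refine hw.reachableIn_compl_start ?_ hpt
    by_contra hno
    exact hp ⟨w, fun c hc hct => hno (by rwa [← Set.mem_singleton_iff.1 hct])⟩
  · obtain ⟨w, hw⟩ : D.tree.ReachableIn {t}ᶜ t₁ t₂ := not_not.1 htb
    have hmem : p ∈ w.support := by
      by_contra hno
      exact hp ⟨w, fun c hc hct => hno (by rwa [← Set.mem_singleton_iff.1 hct])⟩
    exact (ReachableIn.of_mem_support hw hmem).symm.trans ⟨w, hw⟩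

/-- A node `t` that is off the path between `t₁` and `t₂`, or equal to `t₁`, is closer to this
path than all nodes that it separates from `t₂`. -/
theorem exists_distToPath_bound (t₁ t₂ : D.Node) (ht : t ∈ D.between t₁ t₂ → t = t₁) :
    ∃ c, (∀ y ∈ D.part t, D.distToPath t₁ t₂ y ≤ c) ∧
      ∀ x, x ∉ D.part t ∪ D.before t t₂ → c < D.distToPath t₁ t₂ x := by
  classical
  set S : Set ℕ := {n | ∃ p ∈ D.between t₁ t₂, ∃ w : D.tree.Walk t p, w.length = n} with hS
  have hne : S.Nonempty := by
    obtain ⟨w⟩ := D.isTree.1.preconnected t t₁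
    exact ⟨_, t₁, left_mem_between t₁ t₂, w, rfl⟩
  refine ⟨sInf S, fun y hy => ?_, fun x hx => ?_⟩
  · obtain ⟨p, hp, w, hw⟩ := Nat.sInf_mem hne
    exact Nat.sInf_le ⟨t, p, hy, hp, w, hw⟩
  · have hne' : {n | ∃ s p, x ∈ D.part s ∧ p ∈ D.between t₁ t₂ ∧
        ∃ w : D.tree.Walk s p, w.length = n}.Nonempty := by
      obtain ⟨s, hs⟩ := D.exists_mem_part x
      obtain ⟨w⟩ := D.isTree.1.preconnected s t₁
      exact ⟨_, s, t₁, hs, left_mem_between t₁ t₂, w, rfl⟩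
    obtain ⟨s, p, hs, hp, w, hw⟩ := Nat.sInf_mem hne'
    have hst : s ≠ t := fun h => hx (Or.inl (h ▸ hs))
    have hmem : t ∈ w.support := by
      by_contra hno
      have hsp : D.tree.ReachableIn {t}ᶜ s p :=
        ⟨w, fun c hc hct => hno (by rwa [← Set.mem_singleton_iff.1 hct])⟩
      exact hx (Or.inr ⟨s, hs, hsp.trans (reachableIn_of_mem_between hp hsp.right_mem ht)⟩)
    have h1 : (w.takeUntil t hmem).length + (w.dropUntil t hmem).length = w.length := by
      rw [← Walk.length_append, w.take_spec hmem]
    have h2 : (w.takeUntil t hmem).length ≠ 0 := fun h => hst (Walk.eq_of_length_eq_zero h)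
    have h3 : sInf S ≤ (w.dropUntil t hmem).length := Nat.sInf_le ⟨p, hp, _, rfl⟩
    change sInf S < sInf _
    omega

/-- Uncrossing with the separation at a node `t` is strict if the part at `t` is not contained in
`A`. Otherwise the new separation would be as good as the old one but, for `t` on the path between
`t₁` and `t₂` and distinct from `t₁`, bad already for `t` and `t₂`, and in the other cases its
separator would be closer to this path. -/
theorem MinBad.uncross_node [Finite V] (h : D.MinBad A B t₁ t₂) (ht : ¬ D.part t ⊆ A) :
    ((A ∩ B) \ (D.part t ∪ D.before t t₂)).ncard < (D.part t \ A).ncard := by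
  set E := D.part t ∪ D.before t t₂ with hE
  have hsep : G.IsSeparation (D.behind t t₂) E := isSeparation_behind Set.subset_union_right
  have hCE : D.behind t t₂ ∩ E = D.part t := behind_inter_union_before t t₂
  have hsub : D.part t₂ ⊆ E := part_subset_union_before t t₂
  have hle := h.uncross hsep hsub
  rw [hCE] at hle
  refine lt_of_le_of_ne hle fun heq => ?_
  have h1 := ncard_inter_split (A ∩ B) E
  have h2 := h.sep.ncard_corner (C := D.behind t t₂) (E := E)
  rw [hCE] at h2
  have h3 : ((A ∪ D.behind t t₂) ∩ (B ∩ E)).ncard = (A ∩ B).ncard := by omega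
  have hbad := h.toBad.corner hsep hsub h3.le
  by_cases htb : t ∈ D.between t₁ t₂ ∧ t ≠ t₁
  · have hreach := h.toBad.reachable_of_mem_between htb.1
    refine absurd (h.le_dist _ _ t t₂ ⟨hbad.sep, ?_, hbad.right, ?_⟩ h3)
      (not_le.2 (dist_lt_of_mem_between htb.1 htb.2))
    · rw [h3, Set.inter_eq_left.2 ((part_subset_behind t t₂).trans Set.subset_union_right)]
      exact h.toBad.lt_ncard_part hreach
    · rw [h3]
      exact hreach.symm.trans h.reach
  · obtain ⟨c, hc, hc'⟩ := exists_distToPath_bound (D := D) (t := t) t₁ t₂ (by tauto)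
    have hsum := h.le_sum _ _ hbad h3
    set f := D.distToPath t₁ t₂ with hf
    rw [h.sep.corner_inter, hCE] at hsum
    rw [← finsum_mem_inter_add_sdiff E (Set.toFinite (A ∩ B)), finsum_mem_union (Set.disjoint_left.2 fun v hv hv' => hv'.2 hv.1.1)
      (Set.toFinite _) (Set.toFinite _)] at hsum
    obtain ⟨y, hy, hyA⟩ := Set.not_subset.1 ht
    have hpos : 0 < (D.part t \ A).ncard := (Set.ncard_pos).2 ⟨y, hy, hyA⟩
    have h4 : ∑ᶠ x ∈ D.part t \ A, f x ≤ (D.part t \ A).ncard * c := by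
      rw [finsum_mem_eq_finite_toFinset_sum f (Set.toFinite _), Set.ncard_eq_toFinset_card _]
      exact Finset.sum_le_card_nsmul _ _ _ fun x hx => hc x ((Set.Finite.mem_toFinset _).1 hx).1
    have h5 : (D.part t \ A).ncard * (c + 1) ≤ ∑ᶠ x ∈ (A ∩ B) \ E, f x := by
      rw [← heq, finsum_mem_eq_finite_toFinset_sum f (Set.toFinite _),
        Set.ncard_eq_toFinset_card ((A ∩ B) \ E), ← smul_eq_mul]
      refine Finset.card_nsmul_le_sum _ _ _ fun x hx => ?_
      exact hc' x ((Set.Finite.mem_toFinset _).1 hx).2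
    have h6 : (D.part t \ A).ncard * (c + 1) = (D.part t \ A).ncard * c + (D.part t \ A).ncard :=
      by ring
    omega

end Uncross

end TreeDecomposition

/-! ### Splitting a tree-decomposition along a separation -/

theorem ReachableIn.map {V W : Type*} {G : SimpleGraph V} {H : SimpleGraph W} (f : G →g H)
    {S : Set V} {S' : Set W} (hf : ∀ c ∈ S, f c ∈ S') {a b : V} (h : G.ReachableIn S a b) :
    H.ReachableIn S' (f a) (f b) := by
  obtain ⟨w, hw⟩ := h
  refine ⟨w.map f, fun c hc => ?_⟩
  rw [Walk.support_map, List.mem_map] at hc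
  obtain ⟨d, hd, rfl⟩ := hc
  exact hf d (hw d hd)

/-- Two trees, joined by an edge, form a tree. -/
theorem IsTree.sum_sup_edge {N M : Type*} {T : SimpleGraph N} {T' : SimpleGraph M}
    (hT : T.IsTree) (hT' : T'.IsTree) (x : N) (y : M) :
    ((T ⊕g T') ⊔ edge (.inl x) (.inr y)).IsTree := by
  refine ⟨hT.1.sum_sup_edge hT'.1, IsAcyclic.sup_edge_of_not_reachable
    (not_reachable_sum_inl_inr x y) (isAcyclic_iff_forall_adj_isBridge.2 ?_)⟩
  have hbT := isAcyclic_iff_forall_adj_isBridge.1 hT.2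
  have hbT' := isAcyclic_iff_forall_adj_isBridge.1 hT'.2
  rintro (a | a) (b | b) hab
  · refine isBridge_iff.2 fun h => isBridge_iff.1 (hbT hab) ?_
    refine (ReachableIn.of_reachable h).induct
      (P := Sum.elim (fun c => (T.deleteEdges {s(a, b)}).Reachable a c) fun _ => False)
      (Reachable.refl _) ?_
    rintro (c | c) (d | d) - - hcd hc
    · refine Reachable.trans hc (Adj.reachable ?_)
      rw [deleteEdges_adj] at hcd ⊢
      exact ⟨hcd.1, fun h => hcd.2 (by simpa using h)⟩
    · simp [deleteEdges_adj] at hcd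
    · exact hc.elim
    · exact hc
  · simp at hab
  · simp at hab
  · refine isBridge_iff.2 fun h => isBridge_iff.1 (hbT' hab) ?_
    refine (ReachableIn.of_reachable h).induct
      (P := Sum.elim (fun _ => False) fun c => (T'.deleteEdges {s(a, b)}).Reachable a c)
      (Reachable.refl _) ?_
    rintro (c | c) (d | d) - - hcd hc
    · exact hc
    · exact hc.elim
    · simp [deleteEdges_adj] at hcd
    · refine Reachable.trans hc (Adj.reachable ?_)
      rw [deleteEdges_adj] at hcd ⊢
      exact ⟨hcd.1, fun h => hcd.2 (by simpa using h)⟩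

namespace TreeDecomposition

variable {V : Type u} {G : SimpleGraph V} (D : TreeDecomposition G)

/-- The parts of a tree-decomposition of `A` whose part at the node `r` contains the separator
`A ∩ B`: every vertex of the separator is added to all parts between those that contain it
and `r`. -/
def splitPart (A B : Set V) (r t : D.Node) : Set V := A ∩ (D.part t ∪ (B \ D.before t r))

variable {D} {A B : Set V} {t₁ t₂ : D.Node}

theorem splitPart_subset (r t : D.Node) : D.splitPart A B r t ⊆ A := Set.inter_subset_left

theorem inter_subset_splitPart (r : D.Node) : A ∩ B ⊆ D.splitPart A B r r := by
  rintro v ⟨hA, hB⟩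
  refine ⟨hA, Or.inr ⟨hB, ?_⟩⟩
  rintro ⟨s, -, h⟩
  exact h.right_mem rfl

/-- The path from a node whose part contains `v` to `r` runs through parts that contain `v` or
separate it from `r`. -/
theorem mem_part_or_notMem_before {r s t : D.Node} {v : V} (hv : v ∈ D.part s)
    (p : D.tree.Walk s r) (hp : p.IsPath) (ht : t ∈ p.support) :
    v ∈ D.part t ∨ v ∉ D.before t r := by
  by_contra! hcon
  obtain ⟨hvt, s', hs', h⟩ := hcon
  have : D.tree.ReachableIn {t}ᶜ s s' := (D.connectedOn_nodes v s hv s' hs').mono le_rfl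
    fun c hc hct => hvt (Set.mem_singleton_iff.1 hct ▸ hc)
  exact D.isTree.2.mem_of_reachableIn (this.trans h) p hp ht rfl

theorem reachableIn_splitPart {r t : D.Node} {v : V} (hA : v ∈ A) (hB : v ∈ B)
    (h : v ∈ D.splitPart A B r t) :
    D.tree.ReachableIn {t | v ∈ D.splitPart A B r t} t r := by
  have hmem : ∀ s (p : D.tree.Walk s r), v ∈ D.part s → p.IsPath →
      ∀ c ∈ p.support, v ∈ D.splitPart A B r c := fun s p hs hp c hc =>
    ⟨hA, (mem_part_or_notMem_before hs p hp hc).imp id fun h => ⟨hB, h⟩⟩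
  rcases h.2 with h | ⟨-, h⟩
  · obtain ⟨p, hp⟩ := D.isTree.1.exists_path t r
    exact ⟨p, hmem t p h hp⟩
  · obtain ⟨s, hs⟩ := D.exists_mem_part v
    obtain ⟨p, hp⟩ := D.isTree.1.exists_path s r
    have ht : t ∈ p.support := by
      by_contra hno
      exact h ⟨s, hs, p, fun c hc hct => hno (Set.mem_singleton_iff.1 hct ▸ hc)⟩
    have hpr : D.tree.ReachableIn {t | v ∈ D.splitPart A B r t} s r := ⟨p, hmem s p hs hp⟩
    exact (ReachableIn.of_mem_support (hmem s p hs hp) ht).symm.trans hpr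

theorem connectedOn_splitPart (r : D.Node) (v : V) :
    D.tree.ConnectedOn {t | v ∈ D.splitPart A B r t} := by
  intro a ha b hb
  by_cases hB : v ∈ B
  · exact (reachableIn_splitPart ha.1 hB ha).trans (reachableIn_splitPart ha.1 hB hb).symm
  · have h : ∀ t, v ∈ D.splitPart A B r t → v ∈ D.part t := fun t ht =>
      ht.2.resolve_right fun h => hB h.1
    exact (D.connectedOn_nodes v a (h a ha) b (h b hb)).mono le_rfl fun c hc =>
      ⟨ha.1, Or.inl hc⟩

theorem _root_.SimpleGraph.IsSeparation.exists_splitPart_of_mem_part (h : G.IsSeparation A B)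
    {v : V} : ∃ t : D.Node ⊕ D.Node, v ∈ Sum.elim (D.splitPart A B t₂) (D.splitPart B A t₁) t := by
  obtain ⟨t, ht⟩ := D.exists_mem_part v
  rcases h.mem_or v with hv | hv
  exacts [⟨.inl t, hv, Or.inl ht⟩, ⟨.inr t, hv, Or.inl ht⟩]

theorem connectedOn_splitParts (v : V) :
    ((D.tree ⊕g D.tree) ⊔ edge (.inl t₂) (.inr t₁)).ConnectedOn
      {t | v ∈ Sum.elim (D.splitPart A B t₂) (D.splitPart B A t₁) t} := by
  set P := Sum.elim (D.splitPart A B t₂) (D.splitPart B A t₁)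
  set T := (D.tree ⊕g D.tree) ⊔ edge (.inl t₂) (.inr t₁) with hT
  have hl : ∀ a b, v ∈ D.splitPart A B t₂ a → v ∈ D.splitPart A B t₂ b →
      T.ReachableIn {t | v ∈ P t} (.inl a) (.inl b) := fun a b ha hb =>
    ((connectedOn_splitPart t₂ v a ha b hb).map Embedding.sumInl.toHom
      (S' := {t | v ∈ P t}) fun c hc => hc).mono le_sup_left subset_rfl
  have hr : ∀ a b, v ∈ D.splitPart B A t₁ a → v ∈ D.splitPart B A t₁ b →
      T.ReachableIn {t | v ∈ P t} (.inr a) (.inr b) := fun a b ha hb =>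
    ((connectedOn_splitPart t₁ v a ha b hb).map Embedding.sumInr.toHom
      (S' := {t | v ∈ P t}) fun c hc => hc).mono le_sup_left subset_rfl
  have hlr : ∀ a b, v ∈ D.splitPart A B t₂ a → v ∈ D.splitPart B A t₁ b →
      T.ReachableIn {t | v ∈ P t} (.inl a) (.inr b) := by
    intro a b ha hb
    have h2 : v ∈ D.splitPart A B t₂ t₂ := inter_subset_splitPart t₂ ⟨ha.1, hb.1⟩
    have h1 : v ∈ D.splitPart B A t₁ t₁ := inter_subset_splitPart t₁ ⟨hb.1, ha.1⟩
    exact (hl a t₂ ha h2).trans (.trans (.of_adj (by simp [hT, edge_adj]) h2 h1)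
      (hr t₁ b h1 hb))
  rintro (a | a) ha (b | b) hb
  exacts [hl a b ha hb, hlr a b ha hb, (hlr b a hb ha).symm, hr a b ha hb]

variable (D t₁ t₂) in
/-- The tree-decomposition obtained by splitting `D` along a separation `(A, B)`: two copies of
the tree, one of which carries a tree-decomposition of `A` and the other one of `B`, joined by an
edge between nodes whose parts contain the separator. -/
def split (h : G.IsSeparation A B) : TreeDecomposition G where
  Node := D.Node ⊕ D.Node
  tree := (D.tree ⊕g D.tree) ⊔ edge (.inl t₂) (.inr t₁)
  isTree := D.isTree.sum_sup_edge D.isTree t₂ t₁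
  part := Sum.elim (D.splitPart A B t₂) (D.splitPart B A t₁)
  iUnion_part := by
    refine Set.eq_univ_of_forall fun v => Set.mem_iUnion.2 ?_
    exact h.exists_splitPart_of_mem_part
  exists_part_of_adj v w hvw := by
    obtain ⟨t, hv, hw⟩ := D.exists_part_of_adj v w hvw
    rcases h.adj v w hvw with h | h
    exacts [⟨.inl t, ⟨h.1, Or.inl hv⟩, ⟨h.2, Or.inl hw⟩⟩,
      ⟨.inr t, ⟨h.1, Or.inl hv⟩, ⟨h.2, Or.inl hw⟩⟩]
  inter_subset a _ b p hp hc v hv :=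
    (D.isTree.sum_sup_edge D.isTree t₂ t₁).2.mem_of_reachableIn
      (connectedOn_splitParts v a hv.1 b hv.2) p hp hc

/-- The sizes of the adhesion sets do not grow when a part is split along a minimal bad
separation. -/
theorem MinBad.ncard_splitPart_inter_le [Finite V] (h : D.MinBad A B t₁ t₂) {t t' : D.Node}
    (hadj : D.tree.Adj t t') (ht : D.tree.ReachableIn {t}ᶜ t' t₂) :
    (D.splitPart A B t₂ t ∩ D.splitPart A B t₂ t').ncard ≤ (D.part t ∩ D.part t').ncard := by
  have hE : D.part t₂ ⊆ D.before t t₂ := by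
    intro v hv
    exact ⟨t₂, hv, .refl ht.right_mem⟩
  have h1 := h.uncross (isSeparation_behind (D := D) (t := t) (r := t₂) subset_rfl) hE
  have h2 : ((D.behind t t₂ ∩ D.before t t₂) \ A).ncard ≤
      ((D.part t ∩ D.part t') \ A).ncard :=
    Set.ncard_le_ncard (Set.sdiff_subset_sdiff_left (behind_inter_before_subset hadj ht))
  have h3 : D.splitPart A B t₂ t ∩ D.splitPart A B t₂ t' ⊆
      ((D.part t ∩ D.part t') ∩ A) ∪ ((A ∩ B) \ D.before t t₂) := by
    rintro v ⟨⟨hA, hv⟩, -, hv'⟩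
    by_cases hb : v ∈ D.before t t₂
    · have hvt : v ∈ D.part t := hv.resolve_right fun h => h.2 hb
      refine Or.inl ⟨⟨hvt, ?_⟩, hA⟩
      exact (behind_inter_before_subset hadj ht ⟨part_subset_behind t t₂ hvt, hb⟩).2
    · by_cases hvB : v ∈ B
      · exact Or.inr ⟨⟨hA, hvB⟩, hb⟩
      · exact Or.inl ⟨⟨hv.resolve_right fun h => hvB h.1, hv'.resolve_right fun h => hvB h.1⟩, hA⟩
  have h4 := (Set.ncard_le_ncard h3).trans (Set.ncard_union_le _ _)
  have h5 := ncard_inter_split (D.part t ∩ D.part t') A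
  omega

theorem MinBad.ncard_splitPart_inter_le' [Finite V] (h : D.MinBad A B t₁ t₂) {t t' : D.Node}
    (hadj : D.tree.Adj t t') :
    (D.splitPart A B t₂ t ∩ D.splitPart A B t₂ t').ncard ≤ (D.part t ∩ D.part t').ncard := by
  rcases D.isTree.1.reachableIn_compl_or hadj.ne t₂ with ht | ht
  · exact h.ncard_splitPart_inter_le hadj ht
  · rw [Set.inter_comm, Set.inter_comm (D.part t)]
    exact h.ncard_splitPart_inter_le hadj.symm ht

theorem MinBad.ncard_splitPart_lt [Finite V] (h : D.MinBad A B t₁ t₂) {t : D.Node}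
    (ht : ¬ D.part t ⊆ A) : (D.splitPart A B t₂ t).ncard < (D.part t).ncard := by
  have h1 := h.uncross_node ht
  have h2 : D.splitPart A B t₂ t ⊆
      (D.part t ∩ A) ∪ ((A ∩ B) \ (D.part t ∪ D.before t t₂)) := by
    rintro v ⟨hA, hv⟩
    by_cases hvt : v ∈ D.part t
    · exact Or.inl ⟨hvt, hA⟩
    · have := hv.resolve_left hvt
      exact Or.inr ⟨⟨hA, this.1⟩, fun h => h.elim hvt this.2⟩
  have h3 := (Set.ncard_le_ncard h2).trans (Set.ncard_union_le _ _)
  have h4 := ncard_inter_split (D.part t) A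
  omega

theorem splitPart_of_subset [Finite V] (h : D.MinBad A B t₁ t₂) {t : D.Node}
    (ht : D.part t ⊆ A) : D.splitPart A B t₂ t ⊆ D.part t := by
  have h1 := h.uncross (E := D.part t ∪ D.before t t₂)
    (isSeparation_behind (t := t) (r := t₂) Set.subset_union_right) (part_subset_union_before t t₂)
  rw [behind_inter_union_before, Set.sdiff_eq_empty.2 ht, Set.ncard_empty, Nat.le_zero,
    Set.ncard_eq_zero, Set.sdiff_eq_empty] at h1
  rintro v ⟨hA, hv⟩
  by_contra hvt
  obtain ⟨hB, hb⟩ := hv.resolve_left hvt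
  exact (h1 ⟨hA, hB⟩).elim hvt hb

theorem MinBad.adhesionLT_split [Finite V] {k : ℕ} (h : D.MinBad A B t₁ t₂)
    (hk : (A ∩ B).ncard < k) (hD : D.AdhesionLT k) : (D.split t₁ t₂ h.sep).AdhesionLT k := by
  have hcast : ∀ S : Set V, S.encard < k ↔ S.ncard < k := fun S => by
    rw [← (Set.toFinite S).cast_ncard_eq]; exact Nat.cast_lt
  have hjoin : ∀ t t', (D.splitPart A B t₂ t ∩ D.splitPart B A t₁ t').encard < k := fun t t' => by
    rw [hcast]
    exact (Set.ncard_le_ncard (Set.inter_subset_inter (splitPart_subset _ _)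
      (splitPart_subset _ _))).trans_lt hk
  simp only [AdhesionLT, hcast] at hD hjoin ⊢
  rintro (t | t) (t' | t') hadj
  · have hadj : D.tree.Adj t t' := by simpa [split, edge_adj] using hadj
    exact (h.ncard_splitPart_inter_le' hadj).trans_lt (hD t t' hadj)
  · exact hjoin t t'
  · rw [Set.inter_comm]
    exact hjoin t' t
  · have hadj : D.tree.Adj t t' := by simpa [split, edge_adj] using hadj
    exact (h.symm.ncard_splitPart_inter_le' hadj).trans_lt (hD t t' hadj)

/-! ### Lean tree-decompositions of finite graphs -/

variable (D) in
/-- The vertex sets that are contained in a part. -/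
def faces : Set (Set V) := {Q | ∃ t, Q ⊆ D.part t}

/-- Compares families of sets by their members of large size: `𝒬 ≺ 𝒬'` if for some `s` the
members of `𝒬` of size at least `s` form a proper subfamily of those of `𝒬'`. -/
def FacesLT (𝒬 𝒬' : Set (Set V)) : Prop :=
  ∃ s, {Q ∈ 𝒬 | s ≤ Q.ncard} ⊂ {Q ∈ 𝒬' | s ≤ Q.ncard}

theorem wellFounded_facesLT [Finite V] : WellFounded (FacesLT (V := V)) := by
  have : IsTrans _ (FacesLT (V := V)) := ⟨by
    rintro P Q R ⟨s, hs⟩ ⟨s', hs'⟩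
    rcases le_total s s' with hle | hle
    · refine ⟨s', lt_of_le_of_lt ?_ hs'⟩
      exact fun X hX => ⟨(hs.1 ⟨hX.1, hle.trans hX.2⟩).1, hX.2⟩
    · refine ⟨s, lt_of_lt_of_le hs ?_⟩
      exact fun X hX => ⟨(hs'.1 ⟨hX.1, hle.trans hX.2⟩).1, hX.2⟩⟩
  have : Std.Irrefl (FacesLT (V := V)) := ⟨fun P ⟨s, hs⟩ => hs.2 hs.1⟩
  exact Finite.wellFounded_of_trans_of_irrefl _

/-- Some part on the path between the two nodes of a bad tuple is large and meets both strict
sides of the separation. -/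
theorem Bad.exists_crossing_part [Finite V] (h : D.Bad A B t₁ t₂) :
    ∃ t, ¬ D.part t ⊆ A ∧ ¬ D.part t ⊆ B ∧ (A ∩ B).ncard < (D.part t).ncard := by
  by_contra! hno
  have h₁ : D.part t₁ ⊆ A := by
    by_contra hA
    refine absurd h.left (not_lt.2 (Set.ncard_le_ncard fun v hv => ?_))
    have hB : D.part t₁ ⊆ B := by
      by_contra hB
      exact absurd (h.lt_ncard_part (.refl _)) (not_lt.2 (hno t₁ hA hB))
    exact ⟨hv.2, hB hv.1⟩
  have key : ∀ t, (D.thick (A ∩ B).ncard).Reachable t₁ t → D.part t ⊆ A := by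
    intro t ht
    refine (ReachableIn.of_reachable ht).induct (P := fun t => D.part t ⊆ A) h₁ ?_
    intro x y hx _ hxy hxA
    by_contra hA
    have hB : D.part y ⊆ B := by
      by_contra hB
      exact absurd (h.lt_ncard_part (hx.reachable.trans hxy.reachable)) (not_lt.2 (hno y hA hB))
    exact absurd hxy.2 (not_lt.2 (Set.ncard_le_ncard (Set.inter_subset_inter hxA hB)))
  refine absurd h.right (not_lt.2 (Set.ncard_le_ncard fun v hv => ?_))
  exact ⟨key t₂ h.reach hv.1, hv.2⟩

theorem MinBad.facesLT_split [Finite V] (h : D.MinBad A B t₁ t₂) :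
    FacesLT (D.split t₁ t₂ h.sep).faces D.faces := by
  -- a crossing part of maximum size
  obtain ⟨t, ⟨htA, htB, htm⟩, hmax⟩ : ∃ t, (¬ D.part t ⊆ A ∧ ¬ D.part t ⊆ B ∧
      (A ∩ B).ncard < (D.part t).ncard) ∧ ∀ t', ¬ D.part t' ⊆ A → ¬ D.part t' ⊆ B →
        (D.part t').ncard ≤ (D.part t).ncard := by
    have hfin : {P : Set V | ∃ t, D.part t = P ∧ ¬ D.part t ⊆ A ∧ ¬ D.part t ⊆ B ∧
      (A ∩ B).ncard < (D.part t).ncard}.Finite := Set.toFinite _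
    obtain ⟨t₀, ht₀⟩ := h.toBad.exists_crossing_part
    obtain ⟨P, ⟨t, rfl, ht⟩, hP⟩ := hfin.exists_maximalFor Set.ncard _ ⟨_, t₀, rfl, ht₀⟩
    refine ⟨t, ht, fun t' h1 h2 => ?_⟩
    by_contra! hlt
    exact absurd (hP ⟨t', rfl, h1, h2, ht.2.2.trans hlt⟩ hlt.le) (not_le.2 hlt)
  -- the other parts of at least this size survive in one copy and become small in the other
  have hkey : ∀ {A B : Set V} {t₁ t₂ : D.Node} (_ : D.MinBad A B t₁ t₂) (s : ℕ),
      (A ∩ B).ncard < s → (∀ t', ¬ D.part t' ⊆ A → ¬ D.part t' ⊆ B → (D.part t').ncard ≤ s) →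
      ∀ t' Q, Q ⊆ D.splitPart A B t₂ t' → s ≤ Q.ncard → Q ∈ D.faces := by
    intro A B t₁ t₂ h s hs hmax t' Q hQ hsQ
    by_cases hA : D.part t' ⊆ A
    · exact ⟨t', hQ.trans (splitPart_of_subset h hA)⟩
    · have h1 := h.ncard_splitPart_lt hA
      have h2 := Set.ncard_le_ncard hQ
      have hB : D.part t' ⊆ B := by
        by_contra hB
        have := hmax t' hA hB
        omega
      have h3 : D.splitPart A B t₂ t' ⊆ A ∩ B :=
        fun v hv => ⟨hv.1, hv.2.elim (fun h => hB h) fun h => h.1⟩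
      have := Set.ncard_le_ncard h3
      omega
  refine ⟨(D.part t).ncard, fun Q hQ => ?_, fun hsub => ?_⟩
  · obtain ⟨⟨t' | t', hQt⟩, hQs⟩ := hQ
    · exact ⟨hkey h _ htm hmax t' Q hQt hQs, hQs⟩
    · exact ⟨hkey h.symm _ (by rwa [Set.inter_comm]) (fun t' h1 h2 => hmax t' h2 h1) t' Q hQt hQs,
        hQs⟩
  · obtain ⟨⟨t' | t', hQt⟩, -⟩ := hsub ⟨⟨t, subset_rfl⟩, le_rfl⟩
    exacts [htA (hQt.trans (splitPart_subset _ _)), htB (hQt.trans (splitPart_subset _ _))]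

variable (G) in
/-- The tree-decomposition with a single part. -/
def single : TreeDecomposition G where
  Node := PUnit
  tree := ⊥
  isTree := .of_subsingleton
  part _ := Set.univ
  iUnion_part := Set.iUnion_const _
  exists_part_of_adj _ _ _ := ⟨.unit, Set.mem_univ _, Set.mem_univ _⟩
  inter_subset _ _ _ _ _ _ := Set.subset_univ _

/-- A set that separates `Z₁` from `Z₂` is the separator of a separation. -/
theorem _root_.SimpleGraph.Separates.exists_isSeparation {X Z₁ Z₂ : Set V}
    (h : G.Separates X Z₁ Z₂) :
    ∃ A B, G.IsSeparation A B ∧ Z₁ ⊆ A ∧ Z₂ ⊆ B ∧ A ∩ B = X := by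
  set R : Set V := {v | ∃ z ∈ Z₁, G.ReachableIn Xᶜ z v} with hR
  have hadj : ∀ a b, G.Adj a b → a ∈ R → b ∉ X → b ∈ R := by
    rintro a b hab ⟨z, hz, hza⟩ hb
    exact ⟨z, hz, hza.trans (.of_adj hab hza.right_mem hb)⟩
  have hRX : ∀ v ∈ R, v ∉ X := fun v ⟨z, _, h⟩ => h.right_mem
  refine ⟨R ∪ X, Rᶜ, ⟨fun v => ?_, fun a b hab => ?_⟩, fun z hz => ?_, fun z hz => ?_, ?_⟩
  · by_cases hv : v ∈ R
    exacts [Or.inl (Or.inl hv), Or.inr hv]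
  · have h1 := hadj a b hab
    have h2 := hadj b a hab.symm
    simp only [Set.mem_union, Set.mem_compl_iff]
    tauto
  · by_cases hzX : z ∈ X
    exacts [Or.inr hzX, Or.inl ⟨z, hz, .refl hzX⟩]
  · rintro ⟨z', hz', h'⟩
    exact h z' hz' z hz h'
  · ext v
    have := hRX v
    simp only [Set.mem_union, Set.mem_inter_iff, Set.mem_compl_iff]
    tauto

theorem exists_bad_of_not_isLeanUpTo [Finite V] {k : ℕ} (hk : D.AdhesionLT k)
    (h : ¬ D.IsLeanUpTo k) : ∃ A B t₁ t₂, D.Bad A B t₁ t₂ ∧ (A ∩ B).ncard < k := by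
  classical
  simp only [IsLeanUpTo, hk, true_and] at h
  push Not at h
  obtain ⟨t₁, t₂, Z₁, Z₂, l, hZ₁, hZ₂, hc₁, hc₂, hl, hpaths, hedges⟩ := h
  have hsep : ∃ X, G.Separates X Z₁ Z₂ ∧ X.ncard < l := by
    by_contra! hno
    exact hpaths (linked_of_forall_separates G l Z₁ Z₂ hno).hasDisjointSetPaths
  obtain ⟨X, hX, hXl⟩ := hsep
  obtain ⟨A, B, hAB, hA, hB, rfl⟩ := hX.exists_isSeparation
  have hcard : ∀ {Z P S : Set V}, Z.encard = l → Z ⊆ P → Z ⊆ S → l ≤ (P ∩ S).ncard := by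
    intro Z P S hZ hP hS
    have : Z.ncard = l := by
      rw [← (Set.toFinite Z).cast_ncard_eq] at hZ; exact_mod_cast hZ
    exact this ▸ Set.ncard_le_ncard (Set.subset_inter hP hS)
  refine ⟨A, B, t₁, t₂, ⟨hAB, hXl.trans_le (hcard hc₁ hZ₁ hA), hXl.trans_le (hcard hc₂ hZ₂ hB), ?_⟩,
    hXl.trans_le hl⟩
  obtain ⟨p, hp⟩ := D.isTree.1.exists_path t₁ t₂
  refine ⟨p.transfer _ fun e => ?_⟩
  induction e with
  | h t t' =>
    intro he
    have hadj := p.adj_of_mem_edges he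
    have := hedges p hp t t' he
    rw [D.sepOrder_eq hadj, ← (Set.toFinite _).cast_ncard_eq] at this
    exact ⟨hadj, hXl.trans_le (by exact_mod_cast this)⟩

variable (G) in
/-- Finite graphs have `k`-lean tree-decompositions. -/
theorem exists_isLeanUpTo_of_finite [Finite V] (k : ℕ) :
    ∃ D : TreeDecomposition G, D.IsLeanUpTo k := by
  obtain ⟨D, hD, hmin⟩ := (InvImage.wf (fun D : TreeDecomposition G => D.faces)
    wellFounded_facesLT).has_min {D | D.AdhesionLT k} ⟨single G, fun _ _ h => h.elim⟩
  refine ⟨D, ?_⟩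
  by_contra hlean
  obtain ⟨A, B, t₁, t₂, hbad, hlt⟩ := exists_bad_of_not_isLeanUpTo hD hlean
  obtain ⟨A', B', t₁', t₂', hbad', hle⟩ := hbad.exists_minBad
  exact hmin (D.split t₁' t₂' hbad'.sep) (hbad'.adhesionLT_split (hle.trans_lt hlt) hD)
    hbad'.facesLT_split

end TreeDecomposition

/-! ### Lean completions -/

/-- `S` and `S'` are sets of `l` vertices whose union is a clique of `H`. -/
def CliqueLink {V : Type*} (H : SimpleGraph V) (l : ℕ) (S S' : Finset V) : Prop :=
  S.card = l ∧ S'.card = l ∧ H.IsClique (S ∪ S' : Set V)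

/-- The properties of the graph `H` that arises from a `k`-lean tree-decomposition of `G` by making
its parts complete. They are all determined by finite subgraphs of `H`. -/
structure LeanCompletion {V : Type u} (G H : SimpleGraph V) (k : ℕ) : Prop where
  le : G ≤ H
  /-- two vertices with a clique of `k` common neighbours are adjacent -/
  adj_of_isClique : ∀ (N : Finset V) (x y : V), N.card = k → H.IsClique (N : Set V) → x ≠ y →
    (∀ n ∈ N, H.Adj n x) → (∀ n ∈ N, H.Adj n y) → H.Adj x y
  /-- if every vertex of a clique has a neighbour in a connected set, then some vertex of this set
  is adjacent to the whole clique -/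
  exists_forall_adj : ∀ C N : Finset V, C.Nonempty → H.ConnectedOn C → H.IsClique (N : Set V) →
    (∀ n ∈ N, n ∉ C ∧ ∃ c ∈ C, H.Adj n c) → ∃ c ∈ C, ∀ n ∈ N, H.Adj n c
  /-- sets that are linked through cliques of `H` are linked in `G` -/
  hasDisjointSetPaths : ∀ (l : ℕ) (Z₁ Z₂ : Finset V), l ≤ k →
    Relation.TransGen (H.CliqueLink l) Z₁ Z₂ → G.HasDisjointSetPaths Z₁ Z₂ l

section Parts

/-! ### The graph of a family of subtrees -/

variable {V N : Type*} {T : SimpleGraph N} {P : N → Set V}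

/-- The vertices `x` and `y` have a common part. -/
def SharePart (P : N → Set V) (x y : V) : Prop := ∃ t, x ∈ P t ∧ y ∈ P t

/-- Consider finitely many vertices, any two of which share a part. If each of them shares a part
with an element of a connected set `C`, then some part contains all of them together with an element
of `C`: the nodes whose parts meet `C` form a subtree. -/
theorem IsTree.exists_common_part (hT : T.IsTree) (hP : ∀ v, T.ConnectedOn {t | v ∈ P t})
    {C : Set V} (hC : C.Nonempty) (hCP : ∀ c ∈ C, SharePart P c c) {H : SimpleGraph V}
    (hH : ∀ x ∈ C, ∀ y ∈ C, H.Adj x y → SharePart P x y) (hconn : H.ConnectedOn C) (Q : Finset V)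
    (hQ : ∀ x ∈ Q, ∀ y ∈ Q, SharePart P x y) (hQC : ∀ x ∈ Q, ∃ c ∈ C, SharePart P c x) :
    ∃ c ∈ C, ∃ t, c ∈ P t ∧ ∀ x ∈ Q, x ∈ P t := by
  have hCconn : T.ConnectedOn {t | ∃ c ∈ C, c ∈ P t} := by
    rintro s ⟨c, hc, hs⟩ s' ⟨c', hc', hs'⟩
    refine (hconn c hc c' hc').induct
      (P := fun c' => ∀ s', c' ∈ P s' → T.ReachableIn {t | ∃ c ∈ C, c ∈ P t} s s') ?_ ?_ s' hs'
    · exact fun s' hs' => (hP c s hs s' hs').mono le_rfl fun t ht => ⟨c, hc, ht⟩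
    · intro x y hx hy hxy hxs s' hs'
      obtain ⟨t, hxt, hyt⟩ := hH x hx.right_mem y hy hxy
      exact (hxs t hxt).trans ((hP y t hyt s' hs').mono le_rfl fun t ht => ⟨y, hy, ht⟩)
  obtain ⟨c₀, hc₀⟩ := hC
  obtain ⟨t₀, ht₀, -⟩ := hCP c₀ hc₀
  obtain ⟨t, ⟨c, hc, hct⟩, ht⟩ := hT.helly (fun v => {t | v ∈ P t}) hP Q hQ _ hCconn
    ⟨t₀, c₀, hc₀, ht₀⟩ fun x hx => by
      obtain ⟨c, hc, t, hct, hxt⟩ := hQC x hx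
      exact ⟨t, ⟨c, hc, hct⟩, hxt⟩
  exact ⟨c, hc, t, hct, ht⟩

theorem IsTree.exists_forall_mem_part (hT : T.IsTree) (hP : ∀ v, T.ConnectedOn {t | v ∈ P t})
    (Q : Finset V) (hQ : ∀ x ∈ Q, ∀ y ∈ Q, SharePart P x y) : ∃ t, ∀ x ∈ Q, x ∈ P t := by
  have : Nonempty N := hT.1.nonempty
  obtain ⟨t, -, ht⟩ := hT.helly (fun v => {t | v ∈ P t}) hP Q hQ Set.univ
    (fun a _ b _ => .of_reachable (hT.1.preconnected a b)) Set.univ_nonempty fun x hx => by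
      obtain ⟨t, ht, -⟩ := hQ x hx x hx
      exact ⟨t, trivial, ht⟩
  exact ⟨t, ht⟩

/-- A set contained in two parts is contained in all parts between them. -/
theorem IsTree.subset_part_of_mem_support (hT : T.IsTree)
    (hP : ∀ v, T.ConnectedOn {t | v ∈ P t}) {S : Set V} {t t' s : N} (p : T.Walk t t')
    (hp : p.IsPath) (hs : s ∈ p.support) (ht : S ⊆ P t) (ht' : S ⊆ P t') : S ⊆ P s :=
  fun v hv => hT.2.mem_of_reachableIn (hP v t (ht hv) t' (ht' hv)) p hp hs

/-- As adhesion sets have fewer than `k` elements, a set of `k` vertices lies in at most one part. So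
vertices that share a part with it share a part with each other. -/
theorem IsTree.sharePart_of_card (hT : T.IsTree) (hP : ∀ v, T.ConnectedOn {t | v ∈ P t}) {k : ℕ}
    (hk : ∀ t t', T.Adj t t' → (P t ∩ P t').encard < k) {Q : Finset V} (hQ : Q.card = k)
    {x y : V} {t t' : N} (ht : ↑Q ⊆ P t) (ht' : ↑Q ⊆ P t') (hx : x ∈ P t) (hy : y ∈ P t') :
    SharePart P x y := by
  by_cases htt' : t = t'
  · exact ⟨t, hx, htt' ▸ hy⟩
  · obtain ⟨p, hp⟩ := hT.1.exists_path t t'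
    cases p with
    | nil => exact absurd rfl htt'
    | cons hadj p =>
      have h := hT.subset_part_of_mem_support hP _ hp
        (List.mem_cons_of_mem _ p.start_mem_support) ht ht'
      have h2 := (Set.encard_le_encard (Set.subset_inter ht h)).trans_lt (hk _ _ hadj)
      rw [Set.encard_coe_eq_coe_finsetCard, hQ] at h2
      exact absurd h2 (lt_irrefl _)

/-- Sets that are linked through `l`-element subsets of parts lie in parts between which all
adhesion sets have at least `l` elements. -/
theorem IsTree.exists_path_of_transGen (hT : T.IsTree) (hP : ∀ v, T.ConnectedOn {t | v ∈ P t})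
    {l : ℕ} {Z₁ Z₂ : Finset V} (h : Relation.TransGen (fun S S' : Finset V => S.card = l ∧
      S'.card = l ∧ ∀ x ∈ (S ∪ S' : Set V), ∀ y ∈ (S ∪ S' : Set V), SharePart P x y) Z₁ Z₂) :
    ∃ t₁ t₂, ↑Z₁ ⊆ P t₁ ∧ ↑Z₂ ⊆ P t₂ ∧ Z₁.card = l ∧ Z₂.card = l ∧ ∀ p : T.Walk t₁ t₂, p.IsPath →
      ∀ t t', s(t, t') ∈ p.edges → l ≤ (P t ∩ P t').encard := by
  classical
  have hnode : ∀ S S' : Finset V, (∀ x ∈ (S ∪ S' : Set V), ∀ y ∈ (S ∪ S' : Set V),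
      SharePart P x y) → ∃ t, ↑S ⊆ P t ∧ ↑S' ⊆ P t := by
    intro S S' hS
    obtain ⟨t, ht⟩ := hT.exists_forall_mem_part hP (S ∪ S') (by simpa using hS)
    exact ⟨t, fun x hx => ht x (Finset.mem_union_left _ hx),
      fun x hx => ht x (Finset.mem_union_right _ hx)⟩
  -- walks along edges with large adhesion sets
  let Q : N → N → Prop := fun a b => ∃ w : T.Walk a b, ∀ t t', s(t, t') ∈ w.edges →
    l ≤ (P t ∩ P t').encard
  suffices h : ∃ t₁ t₂, ↑Z₁ ⊆ P t₁ ∧ ↑Z₂ ⊆ P t₂ ∧ Z₁.card = l ∧ Z₂.card = l ∧ Q t₁ t₂ by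
    obtain ⟨t₁, t₂, h1, h2, h3, h4, w, hw⟩ := h
    refine ⟨t₁, t₂, h1, h2, h3, h4, fun p hp t t' he => hw t t' ?_⟩
    have : (⟨p, hp⟩ : T.Path t₁ t₂) = w.toPath := (hT.2.subsingleton_path _ _).elim _ _
    have hpw : p = w.toPath := congrArg Subtype.val this
    exact w.edges_toPath_subset_edges (hpw ▸ he)
  induction h with
  | single h =>
    obtain ⟨h1, h2, h3⟩ := h
    obtain ⟨t, ht, ht'⟩ := hnode _ _ h3
    exact ⟨t, t, ht, ht', h1, h2, .nil, by simp⟩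
  | tail _ h ih =>
    obtain ⟨t₁, t₂, hZ₁, hS, hc, hc', w, hw⟩ := ih
    obtain ⟨h1, h2, h3⟩ := h
    obtain ⟨t, ht, ht'⟩ := hnode _ _ h3
    obtain ⟨p, hp⟩ := hT.1.exists_path t₂ t
    refine ⟨t₁, t, hZ₁, ht', hc, h2, w.append p, fun x y hxy => ?_⟩
    rw [Walk.edges_append, List.mem_append] at hxy
    rcases hxy with hxy | hxy
    · exact hw x y hxy
    · have hx := hT.subset_part_of_mem_support hP p hp (p.fst_mem_support_of_mem_edges hxy) hS ht
      have hy := hT.subset_part_of_mem_support hP p hp (p.snd_mem_support_of_mem_edges hxy) hS ht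
      rw [← h1, ← Set.encard_coe_eq_coe_finsetCard]
      exact Set.encard_le_encard (Set.subset_inter hx hy)

end Parts

/-! ### Compactness -/

theorem HasDisjointSetPaths.of_induce {V : Type u} {G : SimpleGraph V} {F : Set V}
    {A B : Set V} {l : ℕ}
    (h : (G.induce F).HasDisjointSetPaths (Subtype.val ⁻¹' A) (Subtype.val ⁻¹' B) l) :
    G.HasDisjointSetPaths A B l := by
  obtain ⟨a, b, p, hp, hdisj⟩ := h
  set f := (Embedding.induce (G := G) F).toHom with hf
  have hinj : Function.Injective f := Subtype.val_injective
  refine ⟨fun i => f (a i), fun i => f (b i), fun i => (p i).map f,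
    fun i => ⟨(Walk.isPath_map_iff_of_injective hinj).2 (hp i).1, (hp i).2.1, (hp i).2.2.1, ?_⟩,
    fun i j hij => ?_⟩
  · intro w hw hwa hwb
    simp only [Walk.support_map, List.mem_map] at hw
    obtain ⟨w, hw, rfl⟩ := hw
    exact (hp i).2.2.2 w hw (fun h => hwa (by rw [h])) (fun h => hwb (by rw [h]))
  · simp only [Walk.support_map]
    exact (List.disjoint_map hinj) (hdisj i j hij)

open Filter in
/-- Every graph has a lean completion, as a limit of the lean completions of its finite induced
subgraphs along an ultrafilter. -/
theorem exists_leanCompletion {V : Type u} (G : SimpleGraph V) (k : ℕ) :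
    ∃ H, G.LeanCompletion H k := by
  classical
  let U : Ultrafilter (Finset V) := Ultrafilter.of atTop
  have hUF : ∀ Q : Finset V, ∀ᶠ F in (U : Filter (Finset V)), Q ⊆ F := fun Q =>
    Ultrafilter.of_le atTop (eventually_ge_atTop Q)
  choose D hD using fun F : Finset V =>
    TreeDecomposition.exists_isLeanUpTo_of_finite (G.induce (F : Set V)) k
  let P : ∀ F : Finset V, (D F).Node → Set V := fun F t => Subtype.val '' (D F).part t
  have hT : ∀ F, (D F).tree.IsTree := fun F => (D F).isTree
  have hP : ∀ F v, (D F).tree.ConnectedOn {t | v ∈ P F t} := by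
    intro F v a ha b hb
    obtain ⟨x, hx, rfl⟩ := ha
    obtain ⟨y, hy, hyx⟩ := hb
    obtain rfl : y = x := Subtype.ext hyx
    exact ((D F).connectedOn_nodes y a hx b hy).mono le_rfl fun t ht => ⟨y, ht, rfl⟩
  have hinter : ∀ F t t', (P F t ∩ P F t').encard = ((D F).part t ∩ (D F).part t').encard := by
    intro F t t'
    rw [← Set.image_inter Subtype.val_injective, Subtype.val_injective.encard_image]
  have hk : ∀ F t t', (D F).tree.Adj t t' → (P F t ∩ P F t').encard < k := by
    intro F t t' h
    rw [hinter]
    exact (hD F).1 t t' h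
  have hrefl : ∀ (F : Finset V), ∀ x ∈ F, SharePart (P F) x x := by
    intro F x hx
    obtain ⟨t, ht⟩ := (D F).exists_mem_part ⟨x, hx⟩
    exact ⟨t, ⟨_, ht, rfl⟩, ⟨_, ht, rfl⟩⟩
  have hsymm : ∀ F x y, SharePart (P F) x y → SharePart (P F) y x :=
    fun F x y ⟨t, hx, hy⟩ => ⟨t, hy, hx⟩
  let H : SimpleGraph V :=
    { Adj := fun x y => x ≠ y ∧ ∀ᶠ F in (U : Filter (Finset V)), SharePart (P F) x y
      symm := ⟨fun x y h => ⟨h.1.symm, h.2.mono fun F => hsymm F x y⟩⟩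
      loopless := ⟨fun x h => h.1 rfl⟩ }
  -- on finite sets, `H` agrees with the completions of most finite subgraphs
  have hagree : ∀ Q : Finset V, ∀ᶠ F in (U : Filter (Finset V)), Q ⊆ F ∧
      ∀ x ∈ Q, ∀ y ∈ Q, (x = y ∨ H.Adj x y) ↔ SharePart (P F) x y := by
    intro Q
    refine (hUF Q).and ((eventually_all_finset Q).2 fun x hx =>
      (eventually_all_finset Q).2 fun y hy => ?_)
    by_cases hxy : x = y
    · subst hxy
      filter_upwards [hUF Q] with F hF
      exact iff_of_true (Or.inl rfl) (hrefl F x (hF hx))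
    · by_cases hadj : ∀ᶠ F in (U : Filter (Finset V)), SharePart (P F) x y
      · exact hadj.mono fun F hF => iff_of_true (Or.inr ⟨hxy, hadj⟩) hF
      · exact (Ultrafilter.eventually_not.2 hadj).mono fun F hF =>
          iff_of_false (fun h => h.elim hxy fun h => hadj h.2) hF
  have hclique : ∀ Q : Set V, H.IsClique Q → ∀ x ∈ Q, ∀ y ∈ Q, x = y ∨ H.Adj x y :=
    fun Q hQ x hx y hy => or_iff_not_imp_left.2 fun h => hQ hx hy h
  refine ⟨H, ?_, ?_, ?_, ?_⟩
  · intro x y hxy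
    refine ⟨hxy.ne, ?_⟩
    filter_upwards [hUF {x, y}] with F hF
    obtain ⟨t, hx, hy⟩ := (D F).exists_part_of_adj ⟨x, hF (by simp)⟩ ⟨y, hF (by simp)⟩ hxy
    exact ⟨t, ⟨_, hx, rfl⟩, ⟨_, hy, rfl⟩⟩
  · intro N x y hN hclq hxy hx hy
    obtain ⟨F, -, hF⟩ := (hagree (insert x (insert y N))).exists
    have hpart : ∀ z ∈ insert x (insert y N), (∀ n ∈ N, H.Adj n z) →
        ∃ t, (N : Set V) ⊆ P F t ∧ z ∈ P F t := by
      intro z hz hNz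
      have hcl : H.IsClique (insert z N : Set V) :=
        hclq.insert fun n hn _ => (hNz n hn).symm
      obtain ⟨t, ht⟩ := (hT F).exists_forall_mem_part (hP F) (insert z N) fun a ha b hb => by
        refine (hF a ?_ b ?_).1 (hclique _ hcl a (by simpa using ha) b (by simpa using hb))
        · rcases Finset.mem_insert.1 ha with rfl | ha
          exacts [hz, by simp [ha]]
        · rcases Finset.mem_insert.1 hb with rfl | hb
          exacts [hz, by simp [hb]]
      exact ⟨t, fun n hn => ht n (by simp at hn; simp [hn]), ht z (by simp)⟩
    obtain ⟨t, ht, hxt⟩ := hpart x (by simp) hx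
    obtain ⟨t', ht', hyt'⟩ := hpart y (by simp) hy
    have := (hT F).sharePart_of_card (hP F) (hk F) hN ht ht' hxt hyt'
    exact ((hF x (by simp) y (by simp)).2 this).resolve_left hxy
  · intro C N hC hconn hclq hN
    obtain ⟨F, hQF, hF⟩ := (hagree (C ∪ N)).exists
    obtain ⟨c, hc, t, hct, ht⟩ := (hT F).exists_common_part (hP F) (C := C) (H := H)
      (by simpa using hC) (fun c hc => hrefl F c (hQF (Finset.mem_union_left _ hc)))
      (fun x hx y hy hxy => (hF x (Finset.mem_union_left _ hx) y (Finset.mem_union_left _ hy)).1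
        (Or.inr hxy)) hconn N
      (fun x hx y hy => (hF x (Finset.mem_union_right _ hx) y (Finset.mem_union_right _ hy)).1
        (hclique _ hclq x hx y hy))
      (fun n hn => by
        obtain ⟨c, hc, hnc⟩ := (hN n hn).2
        exact ⟨c, hc, (hF c (Finset.mem_union_left _ hc) n (Finset.mem_union_right _ hn)).1
          (Or.inr hnc.symm)⟩)
    refine ⟨c, hc, fun n hn => ?_⟩
    refine ((hF n (Finset.mem_union_right _ hn) c (Finset.mem_union_left _ hc)).2
      ⟨t, ht n hn, hct⟩).resolve_left ?_
    rintro rfl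
    exact (hN n hn).1 hc
  · intro l Z₁ Z₂ hl h
    have hev : ∀ᶠ F in (U : Filter (Finset V)),
        Relation.TransGen (fun S S' : Finset V => S.card = l ∧ S'.card = l ∧
          ∀ x ∈ (S ∪ S' : Set V), ∀ y ∈ (S ∪ S' : Set V), SharePart (P F) x y) Z₁ Z₂ := by
      have hstep : ∀ S S', H.CliqueLink l S S' → ∀ᶠ F in (U : Filter (Finset V)),
          S.card = l ∧ S'.card = l ∧
          ∀ x ∈ (S ∪ S' : Set V), ∀ y ∈ (S ∪ S' : Set V), SharePart (P F) x y := by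
        intro S S' hS
        filter_upwards [hagree (S ∪ S')] with F hF
        exact ⟨hS.1, hS.2.1, fun x hx y hy => (hF.2 x (by simpa using hx) y (by simpa using hy)).1
          (hclique _ hS.2.2 x hx y hy)⟩
      induction h with
      | single h => exact (hstep _ _ h).mono fun F hF => .single hF
      | tail _ h ih => exact (ih.and (hstep _ _ h)).mono fun F hF => .tail hF.1 hF.2
    obtain ⟨F, hF⟩ := hev.exists
    obtain ⟨t₁, t₂, h1, h2, h3, h4, hpath⟩ := (hT F).exists_path_of_transGen (hP F) hF
    have hpre : ∀ (Z : Finset V) t, ↑Z ⊆ P F t → Z.card = l →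
        Subtype.val ⁻¹' (Z : Set V) ⊆ (D F).part t ∧
          (Subtype.val ⁻¹' (Z : Set V) : Set (F : Set V)).encard = l := by
      intro Z t hZ hc
      refine ⟨fun x hx => ?_, ?_⟩
      · obtain ⟨y, hy, hyx⟩ := hZ hx
        rwa [← Subtype.ext hyx]
      · rw [← Subtype.val_injective.encard_image, Set.image_preimage_eq_of_subset,
          Set.encard_coe_eq_coe_finsetCard, hc]
        exact fun x hx => by
          obtain ⟨y, hy, rfl⟩ := hZ hx
          exact ⟨y, rfl⟩
    obtain ⟨h5, h6⟩ := hpre Z₁ t₁ h1 h3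
    obtain ⟨h7, h8⟩ := hpre Z₂ t₂ h2 h4
    rcases (hD F).2 t₁ t₂ _ _ l h5 h7 h6 h8 hl with h | ⟨p, hp, t, t', he, hlt⟩
    · exact h.of_induce
    · have hle := hpath p hp t t' he
      rw [(D F).sepOrder_eq (p.adj_of_mem_edges he), ← hinter] at hlt
      exact absurd hlt (not_lt.2 hle)

/-! ### Trees given by levels -/

/-- A graph with levels is a tree if there is exactly one node at level `0` and every other node
has exactly one neighbour one level below and no neighbour at its own level. -/
theorem isTree_of_level {N : Type*} {T : SimpleGraph N} (lev : N → ℕ) (r : N)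
    (hadj : ∀ x y, T.Adj x y → lev x = lev y + 1 ∨ lev y = lev x + 1)
    (huniq : ∀ x y y', T.Adj x y → T.Adj x y' → lev x = lev y + 1 → lev x = lev y' + 1 → y = y')
    (hex : ∀ x n, lev x = n + 1 → ∃ y, T.Adj x y ∧ lev y = n)
    (hroot : ∀ x, lev x = 0 → x = r) : T.IsTree := by
  classical
  have hr : ∀ n x, lev x = n → T.Reachable x r := by
    intro n
    induction n with
    | zero => exact fun x hx => hroot x hx ▸ .refl _
    | succ n ih =>
      intro x hx
      obtain ⟨y, hxy, hy⟩ := hex x n hx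
      exact hxy.reachable.trans (ih y hy)
  refine ⟨(connected_iff _).2 ⟨fun x y => (hr _ x rfl).trans (hr _ y rfl).symm, ⟨r⟩⟩, ?_⟩
  intro v c hc
  -- the two neighbours of a node of maximum level on a cycle coincide
  obtain ⟨x, hx, hmax⟩ := c.support.toFinset.exists_max_image lev ⟨v, by simp⟩
  rw [List.mem_toFinset] at hx
  have hc' := (Walk.isCycle_rotate hx).2 hc
  have hmem : ∀ y ∈ (c.rotate x hx).support, lev y ≤ lev x := fun y hy =>
    hmax y (by rwa [List.mem_toFinset, ← Walk.mem_support_rotate_iff (h := hx)])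
  have hle : ∀ y ∈ (c.rotate x hx).support, T.Adj x y → lev x = lev y + 1 := fun y hy hxy =>
    (hadj x y hxy).resolve_right fun h => by
      have := hmem y hy
      omega
  have h1 := Walk.adj_snd hc'.not_nil
  have h2 := Walk.adj_penultimate hc'.not_nil
  exact hc'.snd_ne_penultimate (huniq x _ _ h1 h2.symm (hle _ (Walk.getVert_mem_support _ _) h1)
    (hle _ (Walk.getVert_mem_support _ _) h2.symm))

/-! ### Cells and bags -/

variable {V : Type u} (H : SimpleGraph V)

/-- The vertices outside `C` with a neighbour in `C`. -/
def boundary (C : Set V) : Set V := {u | u ∉ C ∧ ∃ c ∈ C, H.Adj u c}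

/-- `K` is a maximal clique among those between `boundary C` and `C ∪ boundary C`. -/
def IsBag (C K : Set V) : Prop :=
  H.boundary C ⊆ K ∧ Maximal (fun K => H.IsClique K ∧ K ⊆ C ∪ H.boundary C) K

/-- A choice of a set `K` with `IsBag C K`; it exists if the boundary of `C` is a clique. -/
noncomputable def bag (C : Set V) : Set V := Classical.epsilon (H.IsBag C)

/-- The sets that arise from the vertex set by repeatedly deleting the bag and passing to a
component: `cell n v` is the one that contains `v` after `n` steps, and it is empty if `v` has been
deleted before. -/
noncomputable def cell : ℕ → V → Set V
  | 0, _ => Set.univ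
  | n + 1, v => {w | H.ReachableIn (cell n v \ H.bag (cell n v)) v w}

variable {H}

theorem isBag_bag {C : Set V} (hC : H.IsClique (H.boundary C)) : H.IsBag C (H.bag C) := by
  refine Classical.epsilon_spec (p := H.IsBag C) ?_
  refine zorn_subset_nonempty {K | H.IsClique K ∧ K ⊆ C ∪ H.boundary C} ?_
    (H.boundary C) ⟨hC, Set.subset_union_right⟩
  · intro c hc hchain hne
    refine ⟨⋃₀ c, ⟨?_, Set.sUnion_subset fun s hs => (hc hs).2⟩, fun s => Set.subset_sUnion_of_mem⟩
    rintro x ⟨s, hs, hxs⟩ y ⟨s', hs', hys'⟩ hxy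
    rcases hchain.total hs hs' with h | h
    · exact (hc hs').1 (h hxs) hys' hxy
    · exact (hc hs).1 hxs (h hys') hxy

/-- A bag is a maximal clique of `H`, as far as the vertices of `C` are concerned. -/
theorem IsBag.exists_not_adj {C K : Set V} (hK : H.IsBag C K) {d : V} (hd : d ∈ C) (hdK : d ∉ K) :
    ∃ y ∈ K, y ≠ d ∧ ¬ H.Adj d y := by
  by_contra! h
  refine hdK (hK.2.2 ⟨hK.2.1.1.insert fun y hy hdy => h y hy hdy.symm, ?_⟩
    (Set.subset_insert _ _) (Set.mem_insert _ _))
  exact Set.insert_subset (Or.inl hd) hK.2.1.2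

theorem cell_succ_subset (n : ℕ) (v : V) :
    H.cell (n + 1) v ⊆ H.cell n v \ H.bag (H.cell n v) := fun _ hw => hw.right_mem

theorem cell_anti (v : V) : Antitone fun n => H.cell n v :=
  antitone_nat_of_succ_le fun n => (cell_succ_subset n v).trans Set.sdiff_subset

theorem cell_eq_of_mem {n : ℕ} {v w : V} (h : w ∈ H.cell n v) : H.cell n w = H.cell n v := by
  induction n with
  | zero => rfl
  | succ n ih =>
    have hw := ih (cell_succ_subset n v h).1
    have h : H.ReachableIn (H.cell n v \ H.bag (H.cell n v)) v w := h
    ext x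
    change H.ReachableIn (H.cell n w \ H.bag (H.cell n w)) w x ↔ H.ReachableIn _ v x
    rw [hw]
    exact ⟨h.trans, h.symm.trans⟩

theorem mem_cell_self_succ {n : ℕ} {v : V} :
    v ∈ H.cell (n + 1) v ↔ v ∈ H.cell n v ∧ v ∉ H.bag (H.cell n v) :=
  ⟨fun h => cell_succ_subset n v h, fun h => .refl h⟩

theorem connectedOn_cell_succ (n : ℕ) (v : V) : H.ConnectedOn (H.cell (n + 1) v) := by
  intro a ha b hb
  exact (ReachableIn.inter_reachable ha).symm.trans (ReachableIn.inter_reachable hb)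

theorem boundary_univ : H.boundary Set.univ = ∅ := by
  simp [boundary]

theorem boundary_cell_succ_subset {n : ℕ} {v : V}
    (hn : H.IsClique (H.boundary (H.cell n v))) :
    H.boundary (H.cell (n + 1) v) ⊆ H.bag (H.cell n v) := by
  rintro u ⟨hu, c, hc, huc⟩
  by_contra hub
  by_cases hun : u ∈ H.cell n v
  · have hc' : H.ReachableIn (H.cell n v \ H.bag (H.cell n v)) v c := hc
    exact hu (hc'.trans (.of_adj huc.symm hc'.right_mem ⟨hun, hub⟩))
  · exact hub ((isBag_bag hn).1 ⟨hun, c, (cell_succ_subset n v hc).1, huc⟩)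

theorem isClique_boundary_cell (n : ℕ) (v : V) : H.IsClique (H.boundary (H.cell n v)) := by
  induction n with
  | zero => simp [cell, boundary_univ]
  | succ n ih => exact (isBag_bag ih).2.1.1.subset (boundary_cell_succ_subset ih)

theorem isBag_cell (n : ℕ) (v : V) : H.IsBag (H.cell n v) (H.bag (H.cell n v)) :=
  isBag_bag (isClique_boundary_cell n v)

theorem boundary_cell_subset_bag (n : ℕ) (v : V) :
    H.boundary (H.cell n v) ⊆ H.bag (H.cell n v) := (isBag_cell n v).1

/-- Finitely many vertices with neighbours in a connected set have neighbours in a finite connected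
subset. -/
theorem ConnectedOn.exists_finset {C : Set V} (hC : H.ConnectedOn C) {v : V} (hv : v ∈ C)
    (N : Finset V) (hN : ∀ n ∈ N, ∃ c ∈ C, H.Adj n c) :
    ∃ C' : Finset V, ↑C' ⊆ C ∧ C'.Nonempty ∧ H.ConnectedOn (C' : Set V) ∧
      ∀ n ∈ N, ∃ c ∈ C', H.Adj n c := by
  classical
  have : ∀ n, ∃ S : Finset V, ↑S ⊆ C ∧ v ∈ S ∧ (∀ c ∈ S, H.ReachableIn S v c) ∧
      (n ∈ N → ∃ c ∈ S, H.Adj n c) := by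
    intro n
    by_cases hn : n ∈ N
    · obtain ⟨c, hc, hnc⟩ := hN n hn
      obtain ⟨w, hw⟩ := hC v hv c hc
      refine ⟨w.support.toFinset, fun x hx => hw x (by simpa using hx), by simp, fun d hd => ?_,
        fun _ => ⟨c, by simp, hnc⟩⟩
      exact ReachableIn.of_mem_support (w := w) (by simp) (by simpa using hd)
    · exact ⟨{v}, by simpa using hv, by simp, fun c hc => by
        obtain rfl := Finset.mem_singleton.1 hc
        exact .refl (by simp), fun h => absurd h hn⟩
  choose S hSC hvS hS hSN using this
  have hreach : ∀ c ∈ insert v (N.biUnion S), H.ReachableIn ↑(insert v (N.biUnion S)) v c := by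
    intro c hc
    rcases Finset.mem_insert.1 hc with rfl | hc
    · exact .refl (by simp)
    · obtain ⟨n, hn, hc⟩ := Finset.mem_biUnion.1 hc
      refine (hS n c hc).mono le_rfl fun x hx => ?_
      simp only [Finset.coe_insert, Finset.coe_biUnion, Set.mem_insert_iff, Set.mem_iUnion]
      exact Or.inr ⟨n, hn, hx⟩
  refine ⟨insert v (N.biUnion S), ?_, by simp, fun a ha b hb =>
    (hreach a ha).symm.trans (hreach b hb), fun n hn => ?_⟩
  · intro x hx
    rcases Finset.mem_insert.1 hx with rfl | hx
    · exact hv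
    · obtain ⟨n, hn, hx⟩ := Finset.mem_biUnion.1 hx
      exact hSC n hx
  · obtain ⟨c, hc, hnc⟩ := hSN n hn
    exact ⟨c, Finset.mem_insert_of_mem (Finset.mem_biUnion.2 ⟨n, hn, hc⟩), hnc⟩

namespace LeanCompletion

variable {G : SimpleGraph V} {k : ℕ} (hH : G.LeanCompletion H k)
include hH

/-- Finitely many vertices of the boundary of a connected set that form a clique have a common
neighbour in this set. -/
theorem exists_forall_adj_of_subset_boundary {C : Set V} (hC : H.ConnectedOn C) {v : V}
    (hv : v ∈ C) (N : Finset V) (hN : H.IsClique (N : Set V)) (hNC : ↑N ⊆ H.boundary C) :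
    ∃ c ∈ C, ∀ n ∈ N, H.Adj n c := by
  obtain ⟨C', hC', hne, hconn, hNC'⟩ := hC.exists_finset hv N fun n hn => (hNC hn).2
  obtain ⟨c, hc, h⟩ := hH.exists_forall_adj C' N hne hconn hN fun n hn =>
    ⟨fun h => (hNC hn).1 (hC' h), hNC' n hn⟩
  exact ⟨c, hC' hc, h⟩

/-- The boundaries of cells have fewer than `k` vertices: otherwise the bag could be extended by a
common neighbour, in the cell, of `k` of the vertices of the boundary. -/
theorem encard_boundary_cell_lt (n : ℕ) {v : V} (hv : v ∈ H.cell (n + 1) v) :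
    (H.boundary (H.cell (n + 1) v)).encard < k := by
  by_contra! hle
  obtain ⟨N, hN, hNk⟩ := Set.exists_subset_encard_eq hle
  lift N to Finset V using Set.finite_of_encard_eq_coe hNk
  rw [Set.encard_coe_eq_coe_finsetCard, Nat.cast_inj] at hNk
  have hNb := hN.trans (boundary_cell_succ_subset (isClique_boundary_cell n v))
  have hbag := isBag_cell (H := H) n v
  have hNc : H.IsClique (N : Set V) := hbag.2.1.1.subset hNb
  obtain ⟨d, hd, hdN⟩ := hH.exists_forall_adj_of_subset_boundary (connectedOn_cell_succ n v) hv N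
    hNc hN
  have hd' := cell_succ_subset n v hd
  obtain ⟨y, hy, hyd, hdy⟩ := hbag.exists_not_adj hd'.1 hd'.2
  refine hdy (hH.adj_of_isClique N d y hNk hNc hyd.symm hdN fun m hm => ?_)
  refine hbag.2.1.1 (hNb hm) hy ?_
  rintro rfl
  exact hdy (hdN m hm).symm

theorem exists_mem_bag_mem_cell (n : ℕ) {v : V} (hv : v ∈ H.cell n v) :
    ∃ d ∈ H.cell n v, d ∈ H.bag (H.cell n v) := by
  have hd : ∃ d ∈ H.cell n v, ∀ u ∈ H.boundary (H.cell n v), H.Adj u d := by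
    cases n with
    | zero => exact ⟨v, hv, by simp [cell, boundary_univ]⟩
    | succ n =>
      have hfin := Set.finite_of_encard_le_coe (hH.encard_boundary_cell_lt n hv).le
      obtain ⟨d, hd, h⟩ := hH.exists_forall_adj_of_subset_boundary (connectedOn_cell_succ n v) hv
        hfin.toFinset (by simpa using isClique_boundary_cell (n + 1) v) (by simp)
      exact ⟨d, hd, by simpa using h⟩
  obtain ⟨d, hd, hadj⟩ := hd
  by_contra! hno
  have hbag := isBag_cell (H := H) n v
  obtain ⟨y, hy, hyd, hdy⟩ := hbag.exists_not_adj hd (hno d hd)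
  rcases hbag.2.1.2 hy with h | h
  · exact hno y h hy
  · exact hdy (hadj y h).symm

/-- Every vertex lies in a bag after finitely many steps. Otherwise the boundary of the limit of
its cells, which is finite, lies in the boundary of some cell, which then coincides with the limit
although it meets its own bag. -/
theorem exists_mem_bag_cell (v : V) : ∃ n, v ∈ H.bag (H.cell n v) := by
  by_contra! hno
  have hv : ∀ n, v ∈ H.cell n v := by
    intro n
    induction n with
    | zero => exact Set.mem_univ v
    | succ n ih => exact mem_cell_self_succ.2 ⟨ih, hno n⟩
  set D : Set V := ⋂ n, H.cell n v with hD
  have hDsub : ∀ n, D ⊆ H.cell n v := fun n => Set.iInter_subset _ n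
  have hev : ∀ u ∈ H.boundary D, ∀ᶠ n in Filter.atTop, u ∈ H.boundary (H.cell n v) := by
    rintro u ⟨hu, d, hd, hud⟩
    obtain ⟨m, hm⟩ : ∃ m, u ∉ H.cell m v := by simpa [hD] using hu
    filter_upwards [Filter.eventually_ge_atTop m] with n hn
    exact ⟨fun h => hm (cell_anti v hn h), d, hDsub n hd, hud⟩
  have hfinev : ∀ N : Set V, N.Finite → N ⊆ H.boundary D →
      ∃ n, N ⊆ H.boundary (H.cell (n + 1) v) := by
    intro N hN hND
    have h := (Filter.eventually_all_finite hN).2 fun u hu => hev u (hND hu)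
    obtain ⟨n, hn, hn1⟩ := (h.and (Filter.eventually_ge_atTop 1)).exists
    obtain ⟨m, rfl⟩ := Nat.exists_eq_add_of_le' hn1
    exact ⟨m, hn⟩
  have hlt : (H.boundary D).encard < k := by
    by_contra! hle
    obtain ⟨N, hN, hNk⟩ := Set.exists_subset_encard_eq hle
    obtain ⟨n, hn⟩ := hfinev N (Set.finite_of_encard_eq_coe hNk) hN
    have := (Set.encard_le_encard hn).trans_lt (hH.encard_boundary_cell_lt n (hv _))
    exact absurd this (by simp [hNk])
  obtain ⟨n, hn⟩ := hfinev _ (Set.finite_of_encard_le_coe hlt.le) subset_rfl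
  have hsub : H.cell (n + 1) v ⊆ D := by
    intro w hw
    by_contra hwD
    obtain ⟨x, y, hx, hy, hyD, hxy⟩ := (connectedOn_cell_succ n v v (hv _) w hw).exists_exit
      (T := D) (Set.mem_iInter.2 hv) hwD
    exact (hn ⟨hyD, x, hx.right_mem.2, hxy.symm⟩).1 hy
  obtain ⟨d, hd, hdbag⟩ := hH.exists_mem_bag_mem_cell (n + 1) (hv _)
  exact (cell_succ_subset (n + 1) v (hDsub (n + 2) (hsub hd))).2 hdbag

end LeanCompletion

variable (H) in
/-- A node of the tree: a nonempty cell, together with its level. -/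
@[ext]
structure CellNode where
  /-- the level of the node -/
  lev : ℕ
  /-- the cell -/
  set : Set V
  exists_eq : ∃ v ∈ H.cell lev v, set = H.cell lev v

variable (H) in
/-- The tree of the cells: a cell is joined to the cells of the next level that it contains. -/
def cellTree : SimpleGraph (CellNode H) where
  Adj x y := (x.lev = y.lev + 1 ∧ x.set ⊆ y.set) ∨ (y.lev = x.lev + 1 ∧ y.set ⊆ x.set)
  symm := ⟨fun _ _ h => h.symm⟩
  loopless := ⟨fun _ h => by rcases h with h | h <;> exact absurd h.1 (by simp)⟩

namespace CellNode

/-- The node of the cell `cell n v`. -/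
def of (n : ℕ) (v : V) (h : v ∈ H.cell n v) : CellNode H := ⟨n, H.cell n v, v, h, rfl⟩

theorem eq_of {x : CellNode H} {n : ℕ} {v : V} (hn : x.lev = n) (hv : v ∈ x.set) :
    ∃ h : v ∈ H.cell n v, x = of n v h := by
  obtain ⟨m, C, w, hw, hC⟩ := x
  dsimp only at hn hv hC
  subst hn hC
  have h := cell_eq_of_mem hv
  exact ⟨h ▸ hv, CellNode.ext rfl h.symm⟩

theorem exists_mem (x : CellNode H) : ∃ v, v ∈ x.set := by
  obtain ⟨w, hw, h⟩ := x.exists_eq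
  exact ⟨w, h ▸ hw⟩

theorem adj_of {n : ℕ} {v : V} (h : v ∈ H.cell (n + 1) v) :
    (cellTree H).Adj (of (n + 1) v h) (of n v (mem_cell_self_succ.1 h).1) :=
  Or.inl ⟨rfl, cell_anti v n.le_succ⟩

theorem eq_of_adj {x y : CellNode H} {n : ℕ} (hxy : (cellTree H).Adj x y) (hx : x.lev = n + 1)
    (hy : y.lev = n) {v : V} (hv : v ∈ x.set) :
    ∃ h : v ∈ H.cell (n + 1) v, x = of (n + 1) v h ∧ y = of n v (mem_cell_self_succ.1 h).1 := by
  have hsub : x.set ⊆ y.set := by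
    rcases hxy with h | h
    · exact h.2
    · omega
  obtain ⟨_, hy'⟩ := eq_of hy (hsub hv)
  obtain ⟨h, hx'⟩ := eq_of hx hv
  exact ⟨h, hx', hy'⟩

end CellNode

theorem isTree_cellTree [Nonempty V] : (cellTree H).IsTree := by
  obtain ⟨v₀⟩ := ‹Nonempty V›
  refine isTree_of_level CellNode.lev (.of 0 v₀ (Set.mem_univ _)) ?_ ?_ ?_ ?_
  · rintro x y (h | h)
    exacts [Or.inl h.1, Or.inr h.1]
  · intro x y y' hxy hxy' h h'
    obtain ⟨v, hv⟩ := x.exists_mem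
    obtain ⟨_, _, hy⟩ := CellNode.eq_of_adj hxy h rfl hv
    obtain ⟨_, _, hy'⟩ := CellNode.eq_of_adj hxy' (n := y.lev) h (by omega) hv
    rw [hy, hy']
  · intro x n hx
    obtain ⟨v, hv⟩ := x.exists_mem
    obtain ⟨h, rfl⟩ := CellNode.eq_of hx hv
    exact ⟨_, CellNode.adj_of h, rfl⟩
  · intro x hx
    obtain ⟨v, hv⟩ := x.exists_mem
    obtain ⟨h, rfl⟩ := CellNode.eq_of hx hv
    rfl

namespace LeanCompletion

variable {G : SimpleGraph V} {k : ℕ} (hH : G.LeanCompletion H k)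
include hH

open Classical in
/-- The nodes whose bags contain `v` all lead, inside this set of nodes, to the first cell whose bag
contains `v`. -/
theorem exists_forall_reachableIn_bag (v : V) :
    ∃ (r : ℕ) (hr : v ∈ H.cell r v), v ∈ H.bag (H.cell r v) ∧ (∀ m, v ∈ H.cell m v → m ≤ r) ∧
      ∀ x : CellNode H, v ∈ H.bag x.set →
        (cellTree H).ReachableIn {x | v ∈ H.bag x.set} x (.of r v hr) := by
  have hfirst := hH.exists_mem_bag_cell v
  set r := Nat.find hfirst with hr
  have hrbag : v ∈ H.bag (H.cell r v) := Nat.find_spec hfirst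
  have hmax : ∀ m, v ∈ H.cell m v → m ≤ r := by
    intro m hm
    by_contra! hlt
    exact (cell_succ_subset r v (cell_anti v (Nat.succ_le_of_lt hlt) hm)).2 hrbag
  have hmem : ∀ m ≤ r, v ∈ H.cell m v := by
    intro m
    induction m with
    | zero => exact fun _ => Set.mem_univ v
    | succ m ih => exact fun hm => mem_cell_self_succ.2 ⟨ih (by omega), Nat.find_min hfirst hm⟩
  refine ⟨r, hmem r le_rfl, hrbag, hmax, ?_⟩
  have key : ∀ m (x : CellNode H), x.lev = m → v ∈ H.bag x.set →
      (cellTree H).ReachableIn {x | v ∈ H.bag x.set} x (.of r v (hmem r le_rfl)) := by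
    intro m
    induction m with
    | zero =>
      intro x hx hvx
      obtain ⟨h, rfl⟩ := CellNode.eq_of (v := v) hx (by
        obtain ⟨w, hw⟩ := x.exists_mem
        obtain ⟨h, rfl⟩ := CellNode.eq_of hx hw
        exact Set.mem_univ v)
      have h0 : r = 0 := Nat.le_zero.1 (Nat.find_min' hfirst hvx)
      have : CellNode.of r v (hmem r le_rfl) = CellNode.of 0 v h := by congr 1
      rw [this]
      exact .refl hvx
    | succ m ih =>
      intro x hx hvx
      obtain ⟨w, hw⟩ := x.exists_mem
      obtain ⟨h, rfl⟩ := CellNode.eq_of hx hw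
      rcases (isBag_cell (m + 1) w).2.1.2 hvx with hv | hv
      · obtain ⟨h', he⟩ := CellNode.eq_of (x := .of (m + 1) w h) hx hv
        have hvx' : v ∈ H.bag (H.cell (m + 1) v) := by
          rw [cell_eq_of_mem hv]
          exact hvx
        have hmr : r = m + 1 := le_antisymm (Nat.find_min' hfirst hvx') (hmax _ h')
        have : CellNode.of r v (hmem r le_rfl) = CellNode.of (m + 1) v h' := by congr 1
        rw [he, this]
        exact .refl hvx'
      · have hv' := boundary_cell_succ_subset (isClique_boundary_cell m w) hv
        exact (ReachableIn.of_adj (CellNode.adj_of h) hvx hv').trans (ih _ rfl hv')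
  exact fun x => key _ x rfl

theorem exists_mem_bag_of_adj {v w : V} (h : H.Adj v w) :
    ∃ x : CellNode H, v ∈ H.bag x.set ∧ w ∈ H.bag x.set := by
  obtain ⟨r, hr, hvr, hmax, -⟩ := hH.exists_forall_reachableIn_bag v
  obtain ⟨s, hs, hws, hmax', -⟩ := hH.exists_forall_reachableIn_bag w
  wlog hle : r ≤ s generalizing v w r s
  · obtain ⟨x, hx, hx'⟩ := this h.symm s hs hws hmax' r hr hvr hmax (by omega)
    exact ⟨x, hx', hx⟩
  -- the first bag that contains `w` also contains the vertex `v`, which enters a bag no later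
  refine ⟨.of s w hs, ?_, hws⟩
  by_cases hv : v ∈ H.cell s w
  · have heq := cell_eq_of_mem hv
    have : s ≤ r := hmax s (heq ▸ hv)
    obtain rfl : r = s := by omega
    change v ∈ H.bag (H.cell r w)
    rwa [← heq]
  · exact boundary_cell_subset_bag s w ⟨hv, w, hs, h⟩

/-- The tree-decomposition of `G` into the bags of `H`. -/
noncomputable def treeDecomposition [Nonempty V] : TreeDecomposition G where
  Node := CellNode H
  tree := cellTree H
  isTree := isTree_cellTree
  part x := H.bag x.set
  iUnion_part := by
    refine Set.eq_univ_of_forall fun v => Set.mem_iUnion.2 ?_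
    obtain ⟨r, hr, hvr, -⟩ := hH.exists_forall_reachableIn_bag v
    exact ⟨.of r v hr, hvr⟩
  exists_part_of_adj v w h := hH.exists_mem_bag_of_adj (hH.le h)
  inter_subset x y z p hp hy v hv := by
    obtain ⟨r, hr, -, -, h⟩ := hH.exists_forall_reachableIn_bag v
    exact isTree_cellTree.2.mem_of_reachableIn ((h x hv.1).trans (h z hv.2).symm) p hp hy

theorem isClique_part [Nonempty V] (t : hH.treeDecomposition.Node) :
    H.IsClique (hH.treeDecomposition.part t) := by
  obtain ⟨n, hn⟩ : ∃ n, CellNode.lev t = n := ⟨_, rfl⟩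
  obtain ⟨v, hv⟩ := CellNode.exists_mem t
  obtain ⟨h, rfl⟩ := CellNode.eq_of hn hv
  exact (isBag_cell _ v).2.1.1

theorem adhesionLT [Nonempty V] : hH.treeDecomposition.AdhesionLT k := by
  have key : ∀ x y : CellNode H, (cellTree H).Adj x y → x.lev = y.lev + 1 →
      (H.bag x.set ∩ H.bag y.set).encard < k := by
    intro x y hxy hlev
    obtain ⟨v, hv⟩ := x.exists_mem
    obtain ⟨n, hn⟩ : ∃ n, y.lev = n := ⟨_, rfl⟩
    obtain ⟨h, rfl, rfl⟩ := CellNode.eq_of_adj hxy (hn ▸ hlev) hn hv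
    refine (Set.encard_le_encard ?_).trans_lt (hH.encard_boundary_cell_lt n h)
    rintro u ⟨hu, hu'⟩
    exact ((isBag_cell _ v).2.1.2 hu).resolve_left fun h => (cell_succ_subset _ v h).2 hu'
  rintro x y (hxy | hxy)
  · exact key x y (Or.inl hxy) hxy.1
  · rw [Set.inter_comm]
    exact key y x (Or.inl hxy) hxy.1

/-- If all adhesion sets along a walk of the tree have at least `l` elements, then any two sets of
`l` vertices in the parts at its ends are linked through cliques of `H`. -/
theorem transGen_cliqueLink [Nonempty V] {l : ℕ} {t₁ t₂ : hH.treeDecomposition.Node}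
    (p : hH.treeDecomposition.tree.Walk t₁ t₂) (hp : ∀ t t', s(t, t') ∈ p.edges →
      l ≤ (hH.treeDecomposition.part t ∩ hH.treeDecomposition.part t').encard) :
    ∀ Z₁ Z₂ : Finset V, ↑Z₁ ⊆ hH.treeDecomposition.part t₁ →
      ↑Z₂ ⊆ hH.treeDecomposition.part t₂ → Z₁.card = l → Z₂.card = l →
      Relation.TransGen (H.CliqueLink l) Z₁ Z₂ := by
  induction p with
  | nil =>
    exact fun Z₁ Z₂ h₁ h₂ hc₁ hc₂ =>
      .single ⟨hc₁, hc₂, (hH.isClique_part _).subset (Set.union_subset h₁ h₂)⟩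
  | @cons t s _ hadj p ih =>
    intro Z₁ Z₂ h₁ h₂ hc₁ hc₂
    obtain ⟨S, hS, hSl⟩ := Set.exists_subset_encard_eq (hp t s (by simp))
    lift S to Finset V using Set.finite_of_encard_eq_coe hSl
    rw [Set.encard_coe_eq_coe_finsetCard, Nat.cast_inj] at hSl
    refine .head ⟨hc₁, hSl, (hH.isClique_part t).subset
      (Set.union_subset h₁ (hS.trans Set.inter_subset_left))⟩ ?_
    exact ih (fun x y hxy => hp x y (by simp [hxy])) S Z₂ (hS.trans Set.inter_subset_right) h₂
      hSl hc₂

theorem isLeanUpTo [Nonempty V] : hH.treeDecomposition.IsLeanUpTo k := by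
  refine ⟨hH.adhesionLT, fun t₁ t₂ Z₁ Z₂ l h₁ h₂ hc₁ hc₂ hl => ?_⟩
  by_contra! hcon
  obtain ⟨hno, hedge⟩ := hcon
  lift Z₁ to Finset V using Set.finite_of_encard_eq_coe hc₁
  lift Z₂ to Finset V using Set.finite_of_encard_eq_coe hc₂
  rw [Set.encard_coe_eq_coe_finsetCard, Nat.cast_inj] at hc₁ hc₂
  obtain ⟨p, hp⟩ := hH.treeDecomposition.isTree.1.exists_path t₁ t₂
  refine hno (hH.hasDisjointSetPaths l Z₁ Z₂ hl
    (hH.transGen_cliqueLink p (fun t t' he => ?_) Z₁ Z₂ h₁ h₂ hc₁ hc₂))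
  rw [← hH.treeDecomposition.sepOrder_eq (p.adj_of_mem_edges he)]
  exact hedge p hp t t' he

end LeanCompletion

end SimpleGraph

theorem mainTheorem2 {V : Type u} (G : SimpleGraph V) (k : ℕ) :
    ∃ D : SimpleGraph.TreeDecomposition G, D.IsLeanUpTo k := by
  cases isEmpty_or_nonempty V
  · exact SimpleGraph.TreeDecomposition.exists_isLeanUpTo_of_finite G k
  · obtain ⟨H, hH⟩ := SimpleGraph.exists_leanCompletion G k
    exact ⟨hH.treeDecomposition, hH.isLeanUpTo⟩
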